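/- Consider two bosonic modes ("qumodes") with annihilation operators $a_1,a_2$, quadratures given by $a_j=(q_j+ip_j)/\sqrt2$, and Schwinger operators $S^0=\tfrac12(a_1^\dagger a_1+a_2^\dagger a_2)$, $S^x=\tfrac12(a_1^\dagger a_2+a_2^\dagger a_1)$, $S^y=\tfrac1{2i}(a_1^\dagger a_2-a_2^\dagger a_1)$, $S^z=\tfrac12(a_1^\dagger a_1-a_2^\dagger a_2)$. For $\alpha,\beta,\gamma,\delta\in\mathbb R$ and $\theta\in\mathbb R$ let $$U(\theta)=\exp\bigl[-i\theta(\alpha S^0+\beta S^x+\gamma S^y+\delta S^z)\bigr],\qquad U=U(1).$$ Let $Z$ be a complex symmetric $2\times2$ matrix with positive definite imaginary part, let $|\psi_Z\rangle$ be the Gaussian pure state with wavefunction $$\psi_Z(q)=\det(\operatorname{Im}Z)^{1/4}\,\pi^{-1/2}\exp\bigl(\tfrac i2 q^TZq\bigr),\qquad q\in\mathbb R^2,$$ and let $K=\begin{pmatrix}k_{11}&k_{12}\\k_{12}&k_{22}\end{pmatrix}=(I+iZ)(I-iZ)^{-1}$ be its adjacency matrix. Consider the constraints $$(\alpha+\delta)k_{11}+(\beta-i\gamma)k_{12}=0,\qquad(\beta+i\gamma)k_{12}+(\alpha-\delta)k_{22}=0,$$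 $$2\alpha k_{12}+(\beta-i\gamma)k_{22}+(\beta+i\gamma)k_{11}=0.\tag{$*$}$$ Then: 1. If $K$ satisfies $(*)$, then $U|\psi_Z\rangle=|\psi_Z\rangle$. 2. Put $r=\sqrt{\beta^2+\gamma^2+\delta^2}$. If none of $\alpha$, $\alpha+r$, $\alpha-r$ is a nonzero integer multiple of $2\pi$, then $U|\psi_Z\rangle=|\psi_Z\rangle$ if and only if $K$ satisfies $(*)$. 3. For all $\alpha,\beta,\gamma,\delta$: $U(\theta)|\psi_Z\rangle=|\psi_Z\rangle$ for every $\theta\in\mathbb R$ if and only if $K$ satisfies $(*)$. -/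

import Mathlib

open scoped BigOperators

noncomputable section

namespace Qumodes

/-! ## Two qumodes in the number basis

`n : Fin 2 → ℕ` labels the number state `|n 0, n 1⟩`; a vector is given by its amplitudes
`c n = ⟨n 0, n 1 | c⟩`. -/

/-- The Fock space of two qumodes: square-summable amplitudes in the number basis. -/
abbrev FockSpace : Type := lp (fun _ : Fin 2 → ℕ => ℂ) 2

/-- All families of amplitudes, square-summable or not. Polynomials in the ladder operators act on
all of them, so that unbounded operators need no separate domain. -/
abbrev Amplitudes : Type := (Fin 2 → ℕ) → ℂ

/-- The annihilation operator of qumode `i`: `a |n⟩ = √n |n - 1⟩`. -/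
def annih (i : Fin 2) : Module.End ℂ Amplitudes where
  toFun c := fun n => (Real.sqrt ((n i : ℝ) + 1) : ℂ) * c (n + Pi.single i 1)
  map_add' c d := by funext n; simp [mul_add]
  map_smul' r c := by funext n; simp; ring

/-- The creation operator of qumode `i`: `a† |n⟩ = √(n + 1) |n + 1⟩`.
(The amplitude vanishes where `n i = 0`.) -/
def create (i : Fin 2) : Module.End ℂ Amplitudes where
  toFun c := fun n => (Real.sqrt (n i : ℝ) : ℂ) * c (n - Pi.single i 1)
  map_add' c d := by funext n; simp [mul_add]
  map_smul' r c := by funext n; simp; ring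

/-- `S⁰ = (a₁† a₁ + a₂† a₂) / 2`. -/
def S0 : Module.End ℂ Amplitudes :=
  (1 / 2 : ℂ) • (create 0 * annih 0 + create 1 * annih 1)

/-- `Sˣ = (a₁† a₂ + a₂† a₁) / 2`. -/
def Sx : Module.End ℂ Amplitudes :=
  (1 / 2 : ℂ) • (create 0 * annih 1 + create 1 * annih 0)

/-- `Sʸ = (a₁† a₂ - a₂† a₁) / (2i)`. -/
def Sy : Module.End ℂ Amplitudes :=
  (1 / (2 * Complex.I) : ℂ) • (create 0 * annih 1 - create 1 * annih 0)

/-- `Sᶻ = (a₁† a₁ - a₂† a₂) / 2`. -/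
def Sz : Module.End ℂ Amplitudes :=
  (1 / 2 : ℂ) • (create 0 * annih 0 - create 1 * annih 1)

/-- The general real combination `α S⁰ + β Sˣ + γ Sʸ + δ Sᶻ`. -/
def generator (α β γ δ : ℝ) : Module.End ℂ Amplitudes :=
  (α : ℂ) • S0 + (β : ℂ) • Sx + (γ : ℂ) • Sy + (δ : ℂ) • Sz

/-- `exp[-i (α S⁰ + β Sˣ + γ Sʸ + δ Sᶻ)]` on amplitudes, through the exponential series, which
converges in every component because the generator preserves the total photon number
(`hasSum_evolve`). -/
def evolve (α β γ δ : ℝ) (c : Amplitudes) : Amplitudes := fun n =>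
  ∑' k : ℕ, ((-Complex.I) ^ k / (k.factorial : ℂ)) * ((generator α β γ δ ^ k) c) n

/-! ### The exponential is a well-defined unitary operator -/

/-- The two-component label of a pair. -/
def lab (p : ℕ × ℕ) : Fin 2 → ℕ := ![p.1, p.2]

/-- Inner product of the parts of total photon number `m`. -/
def secInner (m : ℕ) (c d : Amplitudes) : ℂ :=
  ∑ p ∈ Finset.HasAntidiagonal.antidiagonal m, (starRingEnd ℂ) (c (lab p)) * d (lab p)

theorem secInner_conj (m : ℕ) (c d : Amplitudes) :
    (starRingEnd ℂ) (secInner m c d) = secInner m d c := by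
  simp only [secInner, map_sum, map_mul, Complex.conj_conj]
  exact Finset.sum_congr rfl fun p _ => mul_comm _ _

theorem secInner_create_zero (i : Fin 2) (c d : Amplitudes) :
    secInner 0 (create i c) d = 0 := by
  fin_cases i <;> simp [secInner, create, lab]

theorem secInner_create_succ (m : ℕ) (i : Fin 2) (c d : Amplitudes) :
    secInner (m + 1) (create i c) d = secInner m c (annih i d) := by
  fin_cases i
  · simp only [secInner, Finset.Nat.antidiagonal_succ, Finset.sum_cons, Finset.sum_map]
    have h (a b : ℕ) : (![a + 1, b] : Fin 2 → ℕ) - Pi.single 0 1 = ![a, b] := by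
      funext j; fin_cases j <;> simp
    have h' (a b : ℕ) : (![a, b] : Fin 2 → ℕ) + Pi.single 0 1 = ![a + 1, b] := by
      funext j; fin_cases j <;> simp
    simp [create, annih, lab, h, h']
    exact Finset.sum_congr rfl fun p _ => by ring
  · simp only [secInner, Finset.Nat.antidiagonal_succ', Finset.sum_cons, Finset.sum_map]
    have h (a b : ℕ) : (![a, b + 1] : Fin 2 → ℕ) - Pi.single 1 1 = ![a, b] := by
      funext j; fin_cases j <;> simp
    have h' (a b : ℕ) : (![a, b] : Fin 2 → ℕ) + Pi.single 1 1 = ![a, b + 1] := by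
      funext j; fin_cases j <;> simp
    simp [create, annih, lab, h, h']
    exact Finset.sum_congr rfl fun p _ => by ring

theorem secInner_hop (m : ℕ) (i j : Fin 2) (c d : Amplitudes) :
    secInner m (create i (annih j c)) d = secInner m c (create j (annih i d)) := by
  cases m with
  | zero => rw [secInner_create_zero, ← secInner_conj, secInner_create_zero, map_zero]
  | succ m =>
    rw [secInner_create_succ, ← secInner_conj (m + 1), secInner_create_succ, secInner_conj]

theorem secInner_add_left (m : ℕ) (c c' d : Amplitudes) :
    secInner m (c + c') d = secInner m c d + secInner m c' d := by
  simp [secInner, add_mul, Finset.sum_add_distrib]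

theorem secInner_smul_left (m : ℕ) (r : ℂ) (c d : Amplitudes) :
    secInner m (r • c) d = (starRingEnd ℂ) r * secInner m c d := by
  simp [secInner, Finset.mul_sum, mul_assoc]

theorem secInner_add_right (m : ℕ) (c d d' : Amplitudes) :
    secInner m c (d + d') = secInner m c d + secInner m c d' := by
  simp [secInner, mul_add, Finset.sum_add_distrib]

theorem secInner_smul_right (m : ℕ) (r : ℂ) (c d : Amplitudes) :
    secInner m c (r • d) = r * secInner m c d := by
  simp only [secInner, Finset.mul_sum, Pi.smul_apply, smul_eq_mul]
  exact Finset.sum_congr rfl fun p _ => by ring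

theorem secInner_generator (m : ℕ) (α β γ δ : ℝ) (c d : Amplitudes) :
    secInner m (generator α β γ δ c) d = secInner m c (generator α β γ δ d) := by
  simp only [generator, S0, Sx, Sy, Sz, sub_eq_add_neg, ← neg_one_smul ℂ (_ * _),
    LinearMap.add_apply, LinearMap.smul_apply, Module.End.mul_apply, secInner_add_left,
    secInner_smul_left, secInner_add_right, secInner_smul_right, secInner_hop]
  simp only [map_div₀, map_one, map_ofNat, map_mul, map_neg, Complex.conj_I, Complex.conj_ofReal]
  have hI : (1 : ℂ) / (2 * Complex.I) = -Complex.I / 2 := by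
    field_simp; simp
  have hI' : (1 : ℂ) / (2 * -Complex.I) = Complex.I / 2 := by
    field_simp; simp
  rw [hI, hI']
  ring

/-- The part of total photon number `m`. -/
def res (m : ℕ) : Amplitudes →ₗ[ℂ] EuclideanSpace ℂ (Finset.HasAntidiagonal.antidiagonal m) where
  toFun c := WithLp.toLp 2 fun p => c (lab p.1)
  map_add' _ _ := rfl
  map_smul' _ _ := rfl

@[simp] theorem res_apply (m : ℕ) (c : Amplitudes) (p : Finset.HasAntidiagonal.antidiagonal m) :
    res m c p = c (lab p.1) := rfl

/-- Extension of a part of total photon number `m` by zero. -/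
def ext (m : ℕ) : EuclideanSpace ℂ (Finset.HasAntidiagonal.antidiagonal m) →ₗ[ℂ] Amplitudes where
  toFun v := fun n => if h : (n 0, n 1) ∈ Finset.HasAntidiagonal.antidiagonal m then v ⟨(n 0, n 1), h⟩ else 0
  map_add' v w := by funext n; dsimp only [Pi.add_apply, Pi.smul_apply, RingHom.id_apply]; split_ifs <;> simp
  map_smul' r v := by funext n; dsimp only [Pi.add_apply, Pi.smul_apply, RingHom.id_apply]; split_ifs <;> simp

theorem res_ext (m : ℕ) (v : EuclideanSpace ℂ (Finset.HasAntidiagonal.antidiagonal m)) : res m (ext m v) = v := by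
  refine PiLp.ext fun p => ?_
  have h : ((lab p.1) 0, (lab p.1) 1) = p.1 := by simp [lab]
  have h2 : ((lab p.1) 0, (lab p.1) 1) ∈ Finset.HasAntidiagonal.antidiagonal m := h ▸ p.2
  rw [res_apply]
  simp only [ext, LinearMap.coe_mk, AddHom.coe_mk, dif_pos h2]
  rfl

theorem inner_res (m : ℕ) (c d : Amplitudes) : inner ℂ (res m c) (res m d) = secInner m c d := by
  rw [PiLp.inner_apply, secInner, ← Finset.sum_coe_sort (Finset.HasAntidiagonal.antidiagonal m)
    (fun p => (starRingEnd ℂ) (c (lab p)) * d (lab p))]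
  refine Finset.sum_congr rfl fun p _ => ?_
  rw [RCLike.inner_apply, res_apply, res_apply, mul_comm]

theorem res_generator_eq_zero (m : ℕ) (α β γ δ : ℝ) (c : Amplitudes) (h : res m c = 0) :
    res m (generator α β γ δ c) = 0 := by
  rw [← inner_self_eq_zero (𝕜 := ℂ), inner_res, secInner_generator, ← inner_res, h,
    inner_zero_left]

/-- The generator restricted to total photon number `m`. -/
def secGen (m : ℕ) (α β γ δ : ℝ) :
    EuclideanSpace ℂ (Finset.HasAntidiagonal.antidiagonal m) →L[ℂ] EuclideanSpace ℂ (Finset.HasAntidiagonal.antidiagonal m) :=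
  LinearMap.toContinuousLinearMap (res m ∘ₗ generator α β γ δ ∘ₗ ext m)

theorem res_generator (m : ℕ) (α β γ δ : ℝ) (c : Amplitudes) :
    res m (generator α β γ δ c) = secGen m α β γ δ (res m c) := by
  have h := res_generator_eq_zero m α β γ δ (c - ext m (res m c)) (by simp [res_ext])
  rw [map_sub, map_sub, sub_eq_zero] at h
  rw [h]
  rfl

theorem res_generator_pow (m : ℕ) (α β γ δ : ℝ) (c : Amplitudes) (k : ℕ) :
    res m ((generator α β γ δ ^ k) c) = (secGen m α β γ δ ^ k) (res m c) := by
  induction k with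
  | zero => simp
  | succ k ih => rw [pow_succ', pow_succ', Module.End.mul_apply, res_generator, ih]; rfl

theorem hasSum_res (m : ℕ) (α β γ δ : ℝ) (c : Amplitudes) (p : Finset.HasAntidiagonal.antidiagonal m) :
    HasSum (fun k : ℕ => ((-Complex.I) ^ k / (k.factorial : ℂ)) *
      ((generator α β γ δ ^ k) c) (lab p.1))
      (NormedSpace.exp ((-Complex.I) • secGen m α β γ δ) (res m c) p) := by
  have h := NormedSpace.exp_series_hasSum_exp' (𝕂 := ℂ) ((-Complex.I) • secGen m α β γ δ)
  have h2 := h.mapL ((EuclideanSpace.proj p).comp (ContinuousLinearMap.apply ℂ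
    (EuclideanSpace ℂ (Finset.HasAntidiagonal.antidiagonal m)) (res m c)))
  have e : (fun k : ℕ => ((-Complex.I) ^ k / (k.factorial : ℂ)) *
      ((generator α β γ δ ^ k) c) (lab p.1)) = fun k : ℕ =>
      ((EuclideanSpace.proj p).comp (ContinuousLinearMap.apply ℂ
        (EuclideanSpace ℂ (Finset.HasAntidiagonal.antidiagonal m)) (res m c)))
        (((k.factorial : ℂ)⁻¹) • ((-Complex.I) • secGen m α β γ δ) ^ k) := by
    funext k
    have hk : ((generator α β γ δ ^ k) c) (lab p.1) = (secGen m α β γ δ ^ k) (res m c) p := by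
      rw [← res_generator_pow, res_apply]
    rw [hk]
    simp [smul_pow]
    ring
  rw [e]
  exact h2

theorem hasSum_evolve (α β γ δ : ℝ) (c : Amplitudes) (n : Fin 2 → ℕ) :
    HasSum (fun k : ℕ => ((-Complex.I) ^ k / (k.factorial : ℂ)) * ((generator α β γ δ ^ k) c) n)
      (evolve α β γ δ c n) := by
  have h := hasSum_res (n 0 + n 1) α β γ δ c ⟨(n 0, n 1), by simp⟩
  have hn : lab (n 0, n 1) = n := by funext j; fin_cases j <;> rfl
  rw [hn] at h
  exact h.summable.hasSum

theorem res_evolve (m : ℕ) (α β γ δ : ℝ) (c : Amplitudes) :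
    res m (evolve α β γ δ c) =
      NormedSpace.exp ((-Complex.I) • secGen m α β γ δ) (res m c) :=
  PiLp.ext fun p => (hasSum_res m α β γ δ c p).tsum_eq

theorem evolve_ext {c d : Amplitudes} (h : ∀ m, res m c = res m d) : c = d := by
  funext n
  have h1 : res (n 0 + n 1) c ⟨(n 0, n 1), by simp⟩ = res (n 0 + n 1) d ⟨(n 0, n 1), by simp⟩ := by
    rw [h]
  have hn : lab (n 0, n 1) = n := by funext j; fin_cases j <;> rfl
  simpa [hn] using h1

theorem evolve_add (α β γ δ : ℝ) (c d : Amplitudes) :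
    evolve α β γ δ (c + d) = evolve α β γ δ c + evolve α β γ δ d :=
  evolve_ext fun m => by simp only [map_add, res_evolve]

theorem evolve_smul (α β γ δ : ℝ) (r : ℂ) (c : Amplitudes) :
    evolve α β γ δ (r • c) = r • evolve α β γ δ c :=
  evolve_ext fun m => by simp only [map_smul, res_evolve]

theorem generator_neg (α β γ δ : ℝ) : generator (-α) (-β) (-γ) (-δ) = -generator α β γ δ := by
  simp only [generator, Complex.ofReal_neg]
  module

theorem secGen_neg (m : ℕ) (α β γ δ : ℝ) :
    secGen m (-α) (-β) (-γ) (-δ) = -secGen m α β γ δ := by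
  ext v : 1
  simp [secGen, generator_neg]

theorem exp_neg_exp_apply {E : Type*} [NormedAddCommGroup E] [InnerProductSpace ℂ E]
    [CompleteSpace E] (T : E →L[ℂ] E) (v : E) :
    NormedSpace.exp (-T) (NormedSpace.exp T v) = v := by
  let _ : NormedAlgebra ℚ (E →L[ℂ] E) := NormedAlgebra.restrictScalars ℚ ℂ _
  have h : NormedSpace.exp (-T) * NormedSpace.exp T = 1 := by
    rw [← NormedSpace.exp_add_of_commute (Commute.refl T).neg_left, neg_add_cancel,
      NormedSpace.exp_zero]
  exact congrArg (fun A : E →L[ℂ] E => A v) h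

theorem star_exp_mul {A : Type*} [NormedRing A] [NormedAlgebra ℂ A] [CompleteSpace A] [StarRing A] [ContinuousStar A] [StarModule ℂ A]
   (T : A) (hT : star T = T) : star (NormedSpace.exp ((-Complex.I) • T)) * NormedSpace.exp ((-Complex.I) • T) = 1 := by
  let _ : NormedAlgebra ℚ A := NormedAlgebra.restrictScalars ℚ ℂ _
  have h : (-Complex.I) • T ∈ skewAdjoint A := by
    rw [skewAdjoint.mem_iff, star_smul, hT]
    simp
  exact (NormedSpace.exp_mem_unitary_of_mem_skewAdjoint h).1

theorem norm_exp_apply {E : Type*} [NormedAddCommGroup E] [InnerProductSpace ℂ E]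
    [CompleteSpace E] (T : E →L[ℂ] E) (hT : IsSelfAdjoint T) (v : E) :
    ‖NormedSpace.exp ((-Complex.I) • T) v‖ = ‖v‖ := by
  have h := star_exp_mul T hT
  have h2 := congrArg (fun A : E →L[ℂ] E => inner ℂ (A v) v) h
  simp only [ContinuousLinearMap.star_eq_adjoint, mul_apply_eq_comp, ContinuousLinearMap.adjoint_inner_left, one_apply_eq_self] at h2
  rw [inner_self_eq_norm_sq_to_K, inner_self_eq_norm_sq_to_K] at h2
  norm_cast at h2
  exact (sq_eq_sq₀ (norm_nonneg _) (norm_nonneg _)).1 h2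

theorem evolve_neg_evolve (α β γ δ : ℝ) (c : Amplitudes) :
    evolve (-α) (-β) (-γ) (-δ) (evolve α β γ δ c) = c :=
  evolve_ext fun m => by
    rw [res_evolve, res_evolve, secGen_neg, smul_neg, exp_neg_exp_apply]

theorem evolve_evolve_neg (α β γ δ : ℝ) (c : Amplitudes) :
    evolve α β γ δ (evolve (-α) (-β) (-γ) (-δ) c) = c := by
  simpa using evolve_neg_evolve (-α) (-β) (-γ) (-δ) c

theorem secGen_isSelfAdjoint (m : ℕ) (α β γ δ : ℝ) : IsSelfAdjoint (secGen m α β γ δ) := by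
  rw [ContinuousLinearMap.isSelfAdjoint_iff_isSymmetric]
  intro v w
  have h (u : EuclideanSpace ℂ (Finset.HasAntidiagonal.antidiagonal m)) :
      secGen m α β γ δ u = res m (generator α β γ δ (ext m u)) := rfl
  have h2 := secInner_generator m α β γ δ (ext m v) (ext m w)
  rw [← inner_res, ← inner_res, res_ext, res_ext, ← h, ← h] at h2
  exact h2

theorem norm_res_evolve (m : ℕ) (α β γ δ : ℝ) (c : Amplitudes) :
    ‖res m (evolve α β γ δ c)‖ = ‖res m c‖ := by
  rw [res_evolve]
  exact norm_exp_apply _ (secGen_isSelfAdjoint m α β γ δ) _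

/-- Number states sorted by total photon number. -/
def sector : (Σ m : ℕ, Finset.HasAntidiagonal.antidiagonal m) ≃ (Fin 2 → ℕ) :=
  Finset.HasAntidiagonal.sigmaAntidiagonalEquivProd.trans (finTwoArrowEquiv ℕ).symm

theorem hasSum_fiber (c : Amplitudes) (m : ℕ) :
    HasSum (fun p : Finset.HasAntidiagonal.antidiagonal m => ‖c (sector ⟨m, p⟩)‖ ^ 2)
      (‖res m c‖ ^ 2) := by
  rw [EuclideanSpace.norm_sq_eq]
  exact hasSum_fintype (fun p : Finset.HasAntidiagonal.antidiagonal m => ‖c (sector ⟨m, p⟩)‖ ^ 2)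

theorem summable_iff_res (c : Amplitudes) :
    Summable (fun n => ‖c n‖ ^ 2) ↔ Summable (fun m => ‖res m c‖ ^ 2) := by
  rw [← sector.summable_iff, summable_sigma_of_nonneg fun _ => by simp]
  simp only [Function.comp_apply, (hasSum_fiber c _).tsum_eq]
  exact and_iff_right fun m => (hasSum_fiber c m).summable

theorem tsum_eq_tsum_res (c : Amplitudes) (h : Summable (fun n => ‖c n‖ ^ 2)) :
    ∑' n, ‖c n‖ ^ 2 = ∑' m, ‖res m c‖ ^ 2 := by
  rw [← sector.tsum_eq, Summable.tsum_sigma' (f := fun x => ‖c (sector x)‖ ^ 2) (fun m => (hasSum_fiber c m).summable)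
    (sector.summable_iff.2 h)]
  exact tsum_congr fun m => (hasSum_fiber c m).tsum_eq

theorem memℓp_iff (c : Amplitudes) : Memℓp c 2 ↔ Summable (fun n => ‖c n‖ ^ 2) := by
  rw [memℓp_gen_iff (by norm_num)]
  norm_num

theorem memℓp_evolve (α β γ δ : ℝ) {c : Amplitudes} (h : Memℓp c 2) :
    Memℓp (evolve α β γ δ c) 2 := by
  rw [memℓp_iff, summable_iff_res] at h ⊢
  simpa only [norm_res_evolve] using h

theorem tsum_evolve (α β γ δ : ℝ) {c : Amplitudes} (h : Memℓp c 2) :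
    ∑' n, ‖evolve α β γ δ c n‖ ^ 2 = ∑' n, ‖c n‖ ^ 2 := by
  rw [tsum_eq_tsum_res _ ((memℓp_iff _).1 h),
    tsum_eq_tsum_res _ ((memℓp_iff _).1 (memℓp_evolve α β γ δ h))]
  simp only [norm_res_evolve]

/-- The passive unitary `exp[-i (α S⁰ + β Sˣ + γ Sʸ + δ Sᶻ)]` on the Fock space. -/
def passiveUnitary (α β γ δ : ℝ) : FockSpace ≃ₗᵢ[ℂ] FockSpace where
  toFun φ := ⟨evolve α β γ δ φ, memℓp_evolve α β γ δ φ.2⟩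
  invFun φ := ⟨evolve (-α) (-β) (-γ) (-δ) φ, memℓp_evolve _ _ _ _ φ.2⟩
  map_add' φ χ := Subtype.ext (evolve_add α β γ δ φ χ)
  map_smul' r φ := Subtype.ext (evolve_smul α β γ δ r φ)
  left_inv φ := Subtype.ext (evolve_neg_evolve α β γ δ φ)
  right_inv φ := Subtype.ext (evolve_evolve_neg α β γ δ φ)
  norm_map' φ := by
    have h0 : (0 : ℝ) < (2 : ENNReal).toReal := by norm_num
    have key := tsum_evolve α β γ δ φ.2
    rw [lp.norm_eq_tsum_rpow h0, lp.norm_eq_tsum_rpow h0]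
    refine congrArg (· ^ (1 / (2 : ENNReal).toReal)) ?_
    have h3 (x : ℝ) : x ^ (2 : ENNReal).toReal = x ^ 2 := by norm_num
    exact (tsum_congr fun n => h3 _).trans (key.trans (tsum_congr fun n => (h3 _).symm))

/-! ## Gaussian pure states -/

/-- The number wavefunction `⟨x|n⟩` of one qumode (Hermite function), for `[q, p] = i` and
`a = (q + i p) / √2`. `Polynomial.hermite` is the probabilists' Hermite polynomial. -/
def numberWave (n : ℕ) (x : ℝ) : ℝ :=
  Polynomial.aeval (Real.sqrt 2 * x) (Polynomial.hermite n) * Real.exp (-(x ^ 2) / 2) /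
    (Real.pi ^ (1 / 4 : ℝ) * Real.sqrt (n.factorial : ℝ))

/-- The number-basis amplitudes `⟨n 0, n 1 | ψ⟩` of a position-space wavefunction. -/
def numberAmplitudes (ψ : (Fin 2 → ℝ) → ℂ) : Amplitudes := fun n =>
  ∫ q : Fin 2 → ℝ, ((∏ i, numberWave (n i) (q i) : ℝ) : ℂ) * ψ q

/-- `Z = V + i U` with `U` and `V` real symmetric and `U` positive definite. -/
structure IsGaussianGraph (Z : Matrix (Fin 2) (Fin 2) ℂ) : Prop where
  symm : Z.IsSymm
  posDef : (Z.map Complex.im).PosDef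

/-- The wavefunction
`ψ_Z(q) = det(U)^{1/4} π^{-n/4} exp((i/2) qᵀ Z q)` for `n = 2`, where `U = Im Z`. -/
def gaussianWave (Z : Matrix (Fin 2) (Fin 2) ℂ) (q : Fin 2 → ℝ) : ℂ :=
  (((Z.map Complex.im).det ^ (1 / 4 : ℝ) / Real.pi ^ (2 / 4 : ℝ) : ℝ) : ℂ) *
    Complex.exp (Complex.I / 2 * ∑ i, ∑ j, (q i : ℂ) * Z i j * (q j : ℂ))

open MeasureTheory in
theorem integrable_poly (p : Polynomial ℝ) :
    Integrable fun x : ℝ => p.eval x * Real.exp (-(x ^ 2) / 2) := by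
  induction p using Polynomial.induction_on' with
  | add p q hp hq =>
    exact (hp.add hq).congr (Filter.Eventually.of_forall fun x => by simp [add_mul])
  | monomial k a =>
    have h := (integrable_rpow_mul_exp_neg_mul_sq (b := 1 / 2) (by norm_num) (s := (k : ℝ))
      (by have : (0 : ℝ) ≤ k := k.cast_nonneg; linarith)).const_mul a
    refine h.congr (Filter.Eventually.of_forall fun x => ?_)
    simp only [Polynomial.eval_monomial, Real.rpow_natCast]
    rw [mul_assoc, show -(1 / 2) * x ^ 2 = -(x ^ 2) / 2 by ring]

/-- The Hermite polynomial with real coefficients. -/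
def herm (n : ℕ) : Polynomial ℝ := (Polynomial.hermite n).map (Int.castRingHom ℝ)

open Polynomial in
theorem herm_succ (n : ℕ) : herm (n + 1) = X * herm n - derivative (herm n) := by
  simp [herm, hermite_succ, derivative_map]

theorem eval_herm (n : ℕ) (x : ℝ) :
    Polynomial.aeval x (Polynomial.hermite n) = (herm n).eval x := by
  rw [herm, Polynomial.eval_map, Polynomial.aeval_def]
  rfl

open Polynomial in
theorem integral_herm_succ (p : Polynomial ℝ) (n : ℕ) :
    ∫ x : ℝ, (p * herm (n + 1)).eval x * Real.exp (-(x ^ 2) / 2) =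
      ∫ x : ℝ, (derivative p * herm n).eval x * Real.exp (-(x ^ 2) / 2) := by
  have hd (x : ℝ) : HasDerivAt (fun x : ℝ => (p * herm n).eval x * Real.exp (-(x ^ 2) / 2))
      ((derivative p * herm n - p * herm (n + 1)).eval x * Real.exp (-(x ^ 2) / 2)) x := by
    have h1 := (p * herm n).hasDerivAt x
    have h2 : HasDerivAt (fun x : ℝ => Real.exp (-(x ^ 2) / 2))
        (Real.exp (-(x ^ 2) / 2) * (-x)) x := by
      have h3 : HasDerivAt (fun x : ℝ => -(x ^ 2) / 2) (-x) x := by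
        refine (((hasDerivAt_pow 2 x).neg).div_const 2).congr_deriv ?_
        norm_num
        ring
      exact h3.exp
    refine (h1.mul h2).congr_deriv ?_
    simp [herm_succ]
    ring
  have h := MeasureTheory.integral_eq_zero_of_hasDerivAt_of_integrable hd
    (integrable_poly _) (integrable_poly _)
  simp only [eval_sub, sub_mul] at h
  rw [MeasureTheory.integral_sub (integrable_poly _) (integrable_poly _)] at h
  linarith

open Polynomial in
theorem integral_herm (p : Polynomial ℝ) (n : ℕ) :
    ∫ x : ℝ, (p * herm n).eval x * Real.exp (-(x ^ 2) / 2) =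
      ∫ x : ℝ, (derivative^[n] p).eval x * Real.exp (-(x ^ 2) / 2) := by
  induction n generalizing p with
  | zero => simp [herm]
  | succ n ih => rw [integral_herm_succ, ih, Function.iterate_succ_apply]

theorem integral_weight : ∫ x : ℝ, Real.exp (-(x ^ 2) / 2) = Real.sqrt (2 * Real.pi) := by
  have h := integral_gaussian (1 / 2)
  rw [show Real.pi / (1 / 2) = 2 * Real.pi by ring] at h
  rw [← h]
  congr 1; funext x; congr 1; ring

open Polynomial in
theorem integral_herm_herm_of_lt {m n : ℕ} (h : m < n) :
    ∫ x : ℝ, (herm m * herm n).eval x * Real.exp (-(x ^ 2) / 2) = 0 := by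
  rw [integral_herm, iterate_derivative_eq_zero]
  · simp
  · rw [herm]
    exact lt_of_le_of_lt natDegree_map_le (by rwa [natDegree_hermite])

open Polynomial in
theorem integral_herm_self (n : ℕ) :
    ∫ x : ℝ, (herm n * herm n).eval x * Real.exp (-(x ^ 2) / 2) =
      n.factorial * Real.sqrt (2 * Real.pi) := by
  have hm : (herm n).Monic := (hermite_monic n).map _
  have hn : (herm n).natDegree = n := by
    rw [herm, (hermite_monic n).natDegree_map, natDegree_hermite]
  have h : derivative^[n] (herm n) = C (n.factorial : ℝ) := by
    ext k
    rw [coeff_iterate_derivative, coeff_C]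
    rcases Nat.eq_zero_or_pos k with rfl | hk
    · have : (herm n).coeff n = 1 := by
        have h2 := hm.coeff_natDegree
        rwa [hn] at h2
      simp [this, Nat.descFactorial_self]
    · rw [coeff_eq_zero_of_natDegree_lt (by omega), smul_zero, if_neg (by omega)]
  rw [integral_herm, h]
  simp only [eval_C]
  rw [MeasureTheory.integral_const_mul, integral_weight]

theorem numberWave_mul (m n : ℕ) (x : ℝ) :
    numberWave m x * numberWave n x =
      (Real.sqrt Real.pi * (Real.sqrt m.factorial * Real.sqrt n.factorial))⁻¹ *
      ((herm m * herm n).eval (Real.sqrt 2 * x) * Real.exp (-((Real.sqrt 2 * x) ^ 2) / 2)) := by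
  have h1 : (Real.pi ^ (1 / 4 : ℝ)) * Real.pi ^ (1 / 4 : ℝ) = Real.sqrt Real.pi := by
    rw [← Real.rpow_add Real.pi_pos, Real.sqrt_eq_rpow]; norm_num
  have h2 : Real.exp (-((Real.sqrt 2 * x) ^ 2) / 2) =
      Real.exp (-(x ^ 2) / 2) * Real.exp (-(x ^ 2) / 2) := by
    rw [← Real.exp_add, mul_pow, Real.sq_sqrt (by norm_num)]; congr 1; ring
  rw [h2, ← h1, numberWave, numberWave, eval_herm, eval_herm, Polynomial.eval_mul]
  field_simp

theorem integrable_numberWave_mul (m n : ℕ) :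
    MeasureTheory.Integrable fun x => numberWave m x * numberWave n x := by
  simp only [numberWave_mul]
  exact ((integrable_poly (herm m * herm n)).comp_mul_left' (by positivity)).const_mul _

theorem integral_numberWave_mul (m n : ℕ) :
    ∫ x, numberWave m x * numberWave n x = if m = n then 1 else 0 := by
  simp only [numberWave_mul]
  rw [MeasureTheory.integral_const_mul, MeasureTheory.Measure.integral_comp_mul_left
    (fun y => (herm m * herm n).eval y * Real.exp (-(y ^ 2) / 2))]
  rcases lt_trichotomy m n with h | rfl | h
  · rw [integral_herm_herm_of_lt h, if_neg h.ne]; simp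
  · rw [integral_herm_self, if_pos rfl, Real.sqrt_mul (by norm_num), Real.mul_self_sqrt
      (by positivity), abs_of_pos (by positivity), smul_eq_mul]
    have : (m.factorial : ℝ) ≠ 0 := by positivity
    field_simp
  · rw [mul_comm (herm m), integral_herm_herm_of_lt h, if_neg h.ne']; simp

/-- The two-qumode number wavefunction. -/
def numberWave₂ (n : Fin 2 → ℕ) (q : Fin 2 → ℝ) : ℂ := ((∏ i, numberWave (n i) (q i) : ℝ) : ℂ)

theorem numberWave₂_mul (m n : Fin 2 → ℕ) (q : Fin 2 → ℝ) :
    numberWave₂ m q * numberWave₂ n q =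
      ((∏ i, (numberWave (m i) (q i) * numberWave (n i) (q i)) : ℝ) : ℂ) := by
  rw [numberWave₂, numberWave₂, Finset.prod_mul_distrib]
  push_cast
  rfl

theorem integral_numberWave₂_mul (m n : Fin 2 → ℕ) :
    ∫ q, numberWave₂ m q * numberWave₂ n q = if m = n then 1 else 0 := by
  simp only [numberWave₂_mul]
  rw [integral_complex_ofReal, MeasureTheory.integral_fintype_prod_volume_eq_prod
    (f := fun i x => numberWave (m i) x * numberWave (n i) x)]
  simp only [integral_numberWave_mul, Fin.prod_univ_two, funext_iff, Fin.forall_fin_two]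
  split_ifs <;> simp_all

theorem continuous_numberWave (n : ℕ) : Continuous (numberWave n) := by
  unfold numberWave
  simp only [eval_herm]
  fun_prop

theorem continuous_numberWave₂ (n : Fin 2 → ℕ) : Continuous (numberWave₂ n) := by
  have := continuous_numberWave
  unfold numberWave₂
  fun_prop

theorem memLp_numberWave₂ (n : Fin 2 → ℕ) : MeasureTheory.MemLp (numberWave₂ n) 2 := by
  rw [MeasureTheory.memLp_two_iff_integrable_sq_norm
    (continuous_numberWave₂ n).aestronglyMeasurable]
  have h : MeasureTheory.Integrable fun q : Fin 2 → ℝ =>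
      ∏ i, (numberWave (n i) (q i) * numberWave (n i) (q i)) :=
    MeasureTheory.Integrable.fintype_prod (f := fun i x => numberWave (n i) x * numberWave (n i) x)
      fun i => integrable_numberWave_mul _ _
  refine h.congr (Filter.Eventually.of_forall fun q => ?_)
  simp only [numberWave₂, Complex.norm_real, Real.norm_eq_abs, sq_abs]
  rw [Finset.prod_mul_distrib, sq]

theorem orthonormal_numberWave₂ :
    Orthonormal ℂ fun n : Fin 2 → ℕ => (memLp_numberWave₂ n).toLp (numberWave₂ n) := by
  rw [orthonormal_iff_ite]
  intro m n
  rw [MeasureTheory.L2.inner_def, ← integral_numberWave₂_mul]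
  refine MeasureTheory.integral_congr_ae ?_
  filter_upwards [(memLp_numberWave₂ m).coeFn_toLp, (memLp_numberWave₂ n).coeFn_toLp]
    with q h1 h2
  rw [h1, h2, RCLike.inner_apply, mul_comm]
  simp [numberWave₂]

theorem memℓp_numberAmplitudes {ψ : (Fin 2 → ℝ) → ℂ} (hψ : MeasureTheory.MemLp ψ 2) :
    Memℓp (numberAmplitudes ψ) 2 := by
  rw [memℓp_gen_iff (by norm_num)]
  have h := (orthonormal_numberWave₂).inner_products_summable (x := hψ.toLp ψ)
  norm_num
  refine h.congr fun n => ?_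
  congr 2
  rw [MeasureTheory.L2.inner_def, numberAmplitudes]
  refine MeasureTheory.integral_congr_ae ?_
  filter_upwards [(memLp_numberWave₂ n).coeFn_toLp, hψ.coeFn_toLp] with q h1 h2
  rw [h1, h2, RCLike.inner_apply, mul_comm]
  simp [numberWave₂]

theorem norm_gaussianWave_sq (Z : Matrix (Fin 2) (Fin 2) ℂ) (q : Fin 2 → ℝ) :
    ‖gaussianWave Z q‖ ^ 2 =
      ((Z.map Complex.im).det ^ (1 / 4 : ℝ) / Real.pi ^ (2 / 4 : ℝ)) ^ 2 *
      Real.exp (-∑ i, ∑ j, q i * (Z i j).im * q j) := by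
  rw [gaussianWave, norm_mul, Complex.norm_real, mul_pow, Real.norm_eq_abs, sq_abs,
    Complex.norm_exp, ← Real.exp_nat_mul]
  congr 2
  simp [Fin.sum_univ_two]

theorem memLp_gaussianWave {Z : Matrix (Fin 2) (Fin 2) ℂ} (hZ : IsGaussianGraph Z) :
    MeasureTheory.MemLp (gaussianWave Z) 2 := by
  have hc : Continuous (gaussianWave Z) := by unfold gaussianWave; fun_prop
  rw [MeasureTheory.memLp_two_iff_integrable_sq_norm hc.aestronglyMeasurable]
  have hdet := hZ.posDef.det_pos
  rw [Matrix.det_fin_two] at hdet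
  have h0 : 0 < (Z 0 0).im := hZ.posDef.diag_pos (i := 0)
  have h1 : 0 < (Z 1 1).im := hZ.posDef.diag_pos (i := 1)
  have hs : Z 1 0 = Z 0 1 := hZ.symm.apply 0 1
  simp only [Matrix.map_apply, hs] at hdet
  obtain ⟨u, hu⟩ : ∃ u, u = (Z 0 0).im := ⟨_, rfl⟩
  obtain ⟨v, hv⟩ : ∃ v, v = (Z 0 1).im := ⟨_, rfl⟩
  obtain ⟨w, hw⟩ : ∃ w, w = (Z 1 1).im := ⟨_, rfl⟩
  rw [← hu, ← hv, ← hw] at hdet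
  rw [← hu] at h0
  rw [← hw] at h1
  set κ : ℝ := (u * w - v * v) / (u + w) with hκ
  have hκ0 : 0 < κ := by positivity
  have hκu : κ * (u + w) = u * w - v * v := by rw [hκ]; field_simp
  have hlow (x y : ℝ) : κ * (x ^ 2 + y ^ 2) ≤ u * x ^ 2 + 2 * v * (x * y) + w * y ^ 2 := by
    have hu' : 0 < u - κ := by
      rw [hκ, sub_pos, div_lt_iff₀ (by positivity)]; nlinarith [sq_nonneg v, mul_pos h0 h0]
    have e : (u - κ) * (u * x ^ 2 + 2 * v * (x * y) + w * y ^ 2 - κ * (x ^ 2 + y ^ 2)) =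
        ((u - κ) * x + v * y) ^ 2 + (u * w - v * v - κ * (u + w) + κ ^ 2) * y ^ 2 := by ring
    have e2 : 0 ≤ (u - κ) *
        (u * x ^ 2 + 2 * v * (x * y) + w * y ^ 2 - κ * (x ^ 2 + y ^ 2)) := by
      rw [e, hκu]; nlinarith [sq_nonneg ((u - κ) * x + v * y), sq_nonneg (κ * y)]
    have := nonneg_of_mul_nonneg_right e2 hu'
    linarith
  have hg : MeasureTheory.Integrable fun q : Fin 2 → ℝ => ∏ i, Real.exp (-κ * (q i) ^ 2) :=
    MeasureTheory.Integrable.fintype_prod (f := fun _ x => Real.exp (-κ * x ^ 2))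
      fun _ => integrable_exp_neg_mul_sq hκ0
  refine (hg.const_mul
    (((Z.map Complex.im).det ^ (1 / 4 : ℝ) / Real.pi ^ (2 / 4 : ℝ)) ^ 2)).mono'
    (by fun_prop) (Filter.Eventually.of_forall fun q => ?_)
  rw [Real.norm_of_nonneg (by positivity), norm_gaussianWave_sq, ← Real.exp_sum]
  refine mul_le_mul_of_nonneg_left (Real.exp_le_exp.2 ?_) (by positivity)
  simp only [Fin.sum_univ_two, hs, ← hu, ← hv, ← hw]
  have := hlow (q 0) (q 1)
  linarith

/-- The Gaussian pure state `|ψ_Z⟩`: the wavefunction `ψ_Z` expanded in the number basis. -/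
def gaussianState (Z : Matrix (Fin 2) (Fin 2) ℂ) (hZ : IsGaussianGraph Z) : FockSpace :=
  ⟨numberAmplitudes (gaussianWave Z), memℓp_numberAmplitudes (memLp_gaussianWave hZ)⟩

/-- The adjacency matrix `K = (I + i Z) (I - i Z)⁻¹`. -/
def adjacency (Z : Matrix (Fin 2) (Fin 2) ℂ) : Matrix (Fin 2) (Fin 2) ℂ :=
  (1 + Complex.I • Z) * (1 - Complex.I • Z)⁻¹

/-- The three linear constraints on `K = [[k11, k12], [k12, k22]]`. -/
def Constraints (α β γ δ : ℝ) (K : Matrix (Fin 2) (Fin 2) ℂ) : Prop :=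
  ((α : ℂ) + δ) * K 0 0 + (β - Complex.I * γ) * K 0 1 = 0 ∧
  (β + Complex.I * γ) * K 0 1 + ((α : ℂ) - δ) * K 1 1 = 0 ∧
  2 * (α : ℂ) * K 0 1 + (β - Complex.I * γ) * K 1 1 + (β + Complex.I * γ) * K 0 0 = 0

end Qumodes

end

noncomputable section

namespace Qumodes

/-! ### Ladder relations for the number wavefunctions -/

/-! The link between `Z` and the generator `G` is the family of nullifier relations `a_i ψ_Z = ∑ j,
K_ij a_j† ψ_Z` (`annih_eq_adjacency_create`). In the position representation both `√2 a_i` and `√2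
a_i†` act on `ψ_Z` as multiplication by linear forms, namely the components of `(1 + iZ)q` and `(1 -
iZ)q`; integration by parts against Hermite functions transfers this to number amplitudes.

Every term of `G` has one creator and one annihilator. Replacing the annihilator makes `G ψ_Z` half
of a quadratic form in the creation operators, whose three coefficients are the left-hand sides of
the constraints (`generator_numberAmplitudes_gaussianWave`). If they vanish, `G ψ_Z = 0` and the
exponential fixes `ψ_Z`.

Conversely, `G` conserves photon number, so invariance under `U` passes to the two-photon component.
There `G` is a self-adjoint spin-one matrix with eigenvalues among `α`, `α ± r`, and a vector fixed
by `exp(-iG)` involves only eigenvalues in `2πℤ`. When nonzero multiples of `2π` are excluded, the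
two-photon part of `G ψ_Z` vanishes. Its entries are the three coefficients times positive constants
and the vacuum amplitude, which is a nonvanishing Gaussian integral
(`numberAmplitudes_gaussianWave_zero_ne_zero`).

For invariance at all angles, one small `θ ≠ 0` avoids every resonance, and the constraints are
homogeneous in `(α, β, γ, δ)`. -/

open Polynomial in
theorem derivative_herm_succ (n : ℕ) :
    derivative (herm (n + 1)) = ((n : ℝ[X]) + 1) * herm n := by
  induction n with
  | zero => simp [herm]
  | succ n ih =>
    rw [herm_succ (n + 1), derivative_sub, derivative_mul, derivative_X, ih, derivative_mul]
    have h : derivative ((n : ℝ[X]) + 1) = 0 := by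
      rw [derivative_add, derivative_natCast, derivative_one, add_zero]
    rw [h, herm_succ n]
    push_cast
    ring

theorem numberWave_succ (n : ℕ) (x : ℝ) :
    Real.sqrt ((n : ℝ) + 1) * numberWave (n + 1) x =
      (herm (n + 1)).eval (Real.sqrt 2 * x) * Real.exp (-(x ^ 2) / 2) /
        (Real.pi ^ (1 / 4 : ℝ) * Real.sqrt (n.factorial : ℝ)) := by
  have h1 : Real.sqrt ((n + 1).factorial : ℝ) =
      Real.sqrt ((n : ℝ) + 1) * Real.sqrt (n.factorial : ℝ) := by
    rw [Nat.factorial_succ, Nat.cast_mul, Real.sqrt_mul (by positivity)]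
    push_cast
    rfl
  have h2 : Real.sqrt ((n : ℝ) + 1) ≠ 0 := by positivity
  have h3 : Real.sqrt (n.factorial : ℝ) ≠ 0 := by positivity
  rw [numberWave, h1, eval_herm]
  field_simp

/-- The three-term Hermite recurrence with the normalizations put in; it expresses `√2 q = a + a†`.
-/
theorem numberWave_recurrence (n : ℕ) (x : ℝ) :
    Real.sqrt 2 * x * numberWave n x =
      Real.sqrt ((n : ℝ) + 1) * numberWave (n + 1) x +
        Real.sqrt (n : ℝ) * numberWave (n - 1) x := by
  rw [numberWave_succ]
  cases n with
  -- The truncated index `0 - 1` is harmless because its coefficient is `√0`.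
  | zero => simp [numberWave, herm]; ring
  | succ n =>
    have h1 : Real.sqrt ((n + 1).factorial : ℝ) =
        Real.sqrt ((n : ℝ) + 1) * Real.sqrt (n.factorial : ℝ) := by
      rw [Nat.factorial_succ, Nat.cast_mul, Real.sqrt_mul (by positivity)]
      push_cast
      rfl
    have h2 : Real.sqrt ((n : ℝ) + 1) ≠ 0 := by positivity
    have h3 : Real.sqrt (n.factorial : ℝ) ≠ 0 := by positivity
    have h4 : Real.sqrt ((n : ℝ) + 1) ^ 2 = n + 1 := Real.sq_sqrt (by positivity)
    rw [herm_succ (n + 1), derivative_herm_succ]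
    simp only [numberWave, eval_herm, h1, Nat.add_sub_cancel, Polynomial.eval_sub,
      Polynomial.eval_mul, Polynomial.eval_X, Polynomial.eval_add, Polynomial.eval_one,
      Polynomial.eval_natCast, Nat.cast_add, Nat.cast_one]
    field_simp
    rw [h4]
    ring

/-- This is `√2 a† = q - d/dx` solved for the derivative. Only the index `n + 1` occurs, which is
the one `annih` reads off after integration by parts. -/
theorem hasDerivAt_numberWave (n : ℕ) (x : ℝ) :
    HasDerivAt (numberWave n)
      (x * numberWave n x - Real.sqrt 2 * (Real.sqrt ((n : ℝ) + 1) * numberWave (n + 1) x)) x := by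
  have h1 : HasDerivAt (fun x : ℝ => (herm n).eval (Real.sqrt 2 * x))
      ((Polynomial.derivative (herm n)).eval (Real.sqrt 2 * x) * (Real.sqrt 2 * 1)) x :=
    ((herm n).hasDerivAt (Real.sqrt 2 * x)).comp x ((hasDerivAt_id x).const_mul _)
  have h2 : HasDerivAt (fun x : ℝ => Real.exp (-(x ^ 2) / 2))
      (Real.exp (-(x ^ 2) / 2) * (-x)) x := by
    have h3 : HasDerivAt (fun x : ℝ => -(x ^ 2) / 2) (-x) x := by
      refine (((hasDerivAt_pow 2 x).neg).div_const 2).congr_deriv ?_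
      norm_num
      ring
    exact h3.exp
  have h := (h1.mul h2).div_const (Real.pi ^ (1 / 4 : ℝ) * Real.sqrt (n.factorial : ℝ))
  have e : numberWave n = fun x => (herm n).eval (Real.sqrt 2 * x) * Real.exp (-(x ^ 2) / 2) /
      (Real.pi ^ (1 / 4 : ℝ) * Real.sqrt (n.factorial : ℝ)) := by
    funext y
    rw [numberWave, eval_herm]
  have h4 : Real.sqrt 2 ^ 2 = 2 := Real.sq_sqrt (by positivity)
  have h5 : Real.sqrt (n.factorial : ℝ) ≠ 0 := by positivity
  rw [numberWave_succ, herm_succ, e]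
  refine h.congr_deriv ?_
  simp only [Polynomial.eval_sub, Polynomial.eval_mul, Polynomial.eval_X]
  field_simp
  linear_combination (x * (herm n).eval (Real.sqrt 2 * x)) * h4

theorem numberWave₂_recurrence (n : Fin 2 → ℕ) (i : Fin 2) (q : Fin 2 → ℝ) :
    (Real.sqrt 2 : ℂ) * (q i : ℂ) * numberWave₂ n q =
      (Real.sqrt ((n i : ℝ) + 1) : ℂ) * numberWave₂ (n + Pi.single i 1) q +
        (Real.sqrt (n i : ℝ) : ℂ) * numberWave₂ (n - Pi.single i 1) q := by
  have h := numberWave_recurrence (n i) (q i)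
  simp only [numberWave₂]
  norm_cast
  fin_cases i <;> simp [Fin.prod_univ_two] at h ⊢
  · linear_combination numberWave (n 1) (q 1) * h
  · linear_combination numberWave (n 0) (q 0) * h

theorem hasLineDerivAt_numberWave₂ (n : Fin 2 → ℕ) (i : Fin 2) (q : Fin 2 → ℝ) :
    HasLineDerivAt ℝ (numberWave₂ n)
      ((q i : ℂ) * numberWave₂ n q - (Real.sqrt 2 : ℂ) *
        ((Real.sqrt ((n i : ℝ) + 1) : ℂ) * numberWave₂ (n + Pi.single i 1) q))
      q (Pi.single i 1) := by
  have h := hasDerivAt_numberWave (n i) (q i)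
  have hs : HasDerivAt (fun t : ℝ => q i + t) 1 0 := by
    simpa using (hasDerivAt_id (0 : ℝ)).const_add (q i)
  have hc := (show HasDerivAt (numberWave (n i)) _ (q i + 0) by simpa using h).comp (0 : ℝ) hs
  rw [HasLineDerivAt]
  simp only [numberWave₂]
  norm_cast
  refine HasDerivAt.ofReal_comp ?_
  fin_cases i <;> simp [Fin.prod_univ_two, Function.comp_def] at hc ⊢
  · refine (hc.mul_const (numberWave (n 1) (q 1))).congr_deriv ?_
    ring
  · refine (hc.const_mul (numberWave (n 0) (q 0))).congr_deriv ?_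
    ring

/-! ### Number amplitudes of Gaussian states -/

theorem hasLineDerivAt_gaussianWave {Z : Matrix (Fin 2) (Fin 2) ℂ} (hZ : Z.IsSymm) (i : Fin 2)
    (q : Fin 2 → ℝ) :
    HasLineDerivAt ℝ (gaussianWave Z)
      (Complex.I * (∑ j, Z i j * (q j : ℂ)) * gaussianWave Z q) q (Pi.single i 1) := by
  have hs : Z 1 0 = Z 0 1 := hZ.apply 0 1
  have hq (j : Fin 2) : HasDerivAt (fun t : ℝ => (((q + t • (Pi.single i 1 : Fin 2 → ℝ)) j : ℝ) : ℂ))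
      (((Pi.single i 1 : Fin 2 → ℝ) j : ℝ) : ℂ) 0 := by
    refine HasDerivAt.ofReal_comp ?_
    simpa using ((hasDerivAt_id (0 : ℝ)).mul_const ((Pi.single i 1 : Fin 2 → ℝ) j)).const_add (q j)
  rw [HasLineDerivAt]
  simp only [gaussianWave, Fin.sum_univ_two]
  have h := (((((hq 0).mul_const (Z 0 0)).mul (hq 0)).add
    (((hq 0).mul_const (Z 0 1)).mul (hq 1))).add
    ((((hq 1).mul_const (Z 1 0)).mul (hq 0)).add
    (((hq 1).mul_const (Z 1 1)).mul (hq 1)))).const_mul (Complex.I / 2)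
  refine (h.cexp.const_mul
    (((Z.map Complex.im).det ^ (1 / 4 : ℝ) / Real.pi ^ (2 / 4 : ℝ) : ℝ) : ℂ)).congr_deriv ?_
  simp only [Pi.mul_apply, Pi.add_apply, zero_smul, Pi.zero_apply, add_zero]
  fin_cases i <;> simp [hs] <;> ring

theorem integrable_numberWave₂_mul {ψ : (Fin 2 → ℝ) → ℂ} (hψ : MeasureTheory.MemLp ψ 2)
    (n : Fin 2 → ℕ) : MeasureTheory.Integrable fun q => numberWave₂ n q * ψ q :=
  (memLp_numberWave₂ n).integrable_mul hψ

/-- The recurrence turns `q_i` times a number wave into a combination of two number waves, so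
square-integrability of `ψ` suffices and no decay estimate is needed. -/
theorem integrable_coord_mul_numberWave₂_mul {ψ : (Fin 2 → ℝ) → ℂ}
    (hψ : MeasureTheory.MemLp ψ 2) (n : Fin 2 → ℕ) (i : Fin 2) :
    MeasureTheory.Integrable fun q => (q i : ℂ) * (numberWave₂ n q * ψ q) := by
  have h2 : (Real.sqrt 2 : ℂ) ≠ 0 := by
    exact_mod_cast (Real.sqrt_pos.2 (by norm_num : (0 : ℝ) < 2)).ne'
  have h := ((((integrable_numberWave₂_mul hψ (n + Pi.single i 1)).const_mul
    (Real.sqrt ((n i : ℝ) + 1) : ℂ)).add ((integrable_numberWave₂_mul hψ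
      (n - Pi.single i 1)).const_mul (Real.sqrt (n i : ℝ) : ℂ))).const_mul (Real.sqrt 2 : ℂ)⁻¹)
  refine h.congr (Filter.Eventually.of_forall fun q => ?_)
  have e := numberWave₂_recurrence n i q
  simp only [Pi.add_apply]
  field_simp
  linear_combination -ψ q * e

/-- The amplitudes of `√2 q_i ψ` are those of `(a_i + a_i†) ψ`. -/
theorem annih_add_create_numberAmplitudes {ψ : (Fin 2 → ℝ) → ℂ} (hψ : MeasureTheory.MemLp ψ 2)
    (n : Fin 2 → ℕ) (i : Fin 2) :
    annih i (numberAmplitudes ψ) n + create i (numberAmplitudes ψ) n =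
      Real.sqrt 2 * ∫ q : Fin 2 → ℝ, (q i : ℂ) * (numberWave₂ n q * ψ q) := by
  simp only [annih, create, LinearMap.coe_mk, AddHom.coe_mk, numberAmplitudes]
  simp only [← numberWave₂.eq_def]
  rw [← MeasureTheory.integral_const_mul, ← MeasureTheory.integral_const_mul,
    ← MeasureTheory.integral_const_mul, ← MeasureTheory.integral_add
      ((integrable_numberWave₂_mul hψ _).const_mul _)
      ((integrable_numberWave₂_mul hψ _).const_mul _)]
  refine MeasureTheory.integral_congr_ae (Filter.Eventually.of_forall fun q => ?_)
  have e := numberWave₂_recurrence n i q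
  simp only
  linear_combination -ψ q * e

/-- For a Gaussian wavefunction, `√2 a_i ψ = ((1 + iZ) q)_i ψ`. -/
theorem annih_numberAmplitudes_gaussianWave {Z : Matrix (Fin 2) (Fin 2) ℂ}
    (hZ : IsGaussianGraph Z) (n : Fin 2 → ℕ) (i : Fin 2) :
    Real.sqrt 2 * annih i (numberAmplitudes (gaussianWave Z)) n =
      ∑ j, ((1 : Matrix (Fin 2) (Fin 2) ℂ) + Complex.I • Z) i j *
        ∫ q : Fin 2 → ℝ, (q j : ℂ) * (numberWave₂ n q * gaussianWave Z q) := by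
  have hψ := memLp_gaussianWave hZ
  have hX (j : Fin 2) := integrable_coord_mul_numberWave₂_mul hψ n j
  have hN := integrable_numberWave₂_mul hψ
  have hA : MeasureTheory.Integrable fun q => (Real.sqrt 2 : ℂ) *
      ((Real.sqrt ((n i : ℝ) + 1) : ℂ) * (numberWave₂ (n + Pi.single i 1) q * gaussianWave Z q)) :=
    ((hN _).const_mul _).const_mul _
  have hB : MeasureTheory.Integrable fun q : Fin 2 → ℝ =>
      Complex.I * Z i 0 * ((q 0 : ℂ) * (numberWave₂ n q * gaussianWave Z q)) +
      Complex.I * Z i 1 * ((q 1 : ℂ) * (numberWave₂ n q * gaussianWave Z q)) :=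
    ((hX 0).const_mul _).add ((hX 1).const_mul _)
  have e1 (q : Fin 2 → ℝ) : ((q i : ℂ) * numberWave₂ n q - (Real.sqrt 2 : ℂ) *
        ((Real.sqrt ((n i : ℝ) + 1) : ℂ) * numberWave₂ (n + Pi.single i 1) q)) * gaussianWave Z q =
      (q i : ℂ) * (numberWave₂ n q * gaussianWave Z q) - (Real.sqrt 2 : ℂ) *
      ((Real.sqrt ((n i : ℝ) + 1) : ℂ) *
        (numberWave₂ (n + Pi.single i 1) q * gaussianWave Z q)) := by ring
  have e2 (q : Fin 2 → ℝ) : numberWave₂ n q *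
        (Complex.I * (∑ j, Z i j * (q j : ℂ)) * gaussianWave Z q) =
      Complex.I * Z i 0 * ((q 0 : ℂ) * (numberWave₂ n q * gaussianWave Z q)) +
      Complex.I * Z i 1 * ((q 1 : ℂ) * (numberWave₂ n q * gaussianWave Z q)) := by
    rw [Fin.sum_univ_two]; ring
  -- Integration by parts along axis `i`: the derivative of the Gaussian supplies `i(Zq)_i`, that of
  -- the number wave supplies `q_i` and the raised index.
  have h := integral_bilinear_hasLineDerivAt_right_eq_neg_left_of_integrable
    (μ := MeasureTheory.volume) (B := ContinuousLinearMap.mul ℝ ℂ)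
    (f := numberWave₂ n) (g := gaussianWave Z) (v := Pi.single i 1)
    (by simp only [ContinuousLinearMap.mul_apply', e1]; exact (hX i).sub hA)
    (by simp only [ContinuousLinearMap.mul_apply', e2]; exact hB)
    (by simpa only [ContinuousLinearMap.mul_apply'] using hN n)
    (fun q _ => hasLineDerivAt_numberWave₂ n i q)
    (fun q _ => hasLineDerivAt_gaussianWave hZ.symm i q)
  simp only [ContinuousLinearMap.mul_apply', e1, e2] at h
  rw [MeasureTheory.integral_sub (hX i) hA,
    MeasureTheory.integral_add ((hX 0).const_mul _) ((hX 1).const_mul _)] at h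
  simp only [MeasureTheory.integral_const_mul] at h
  have ha : annih i (numberAmplitudes (gaussianWave Z)) n = (Real.sqrt ((n i : ℝ) + 1) : ℂ) *
      ∫ q, numberWave₂ (n + Pi.single i 1) q * gaussianWave Z q := rfl
  rw [ha, Fin.sum_univ_two]
  simp only [Matrix.add_apply, Matrix.smul_apply, smul_eq_mul]
  fin_cases i <;> simp [Matrix.one_apply] at h ⊢ <;> linear_combination -h

/-- For a Gaussian wavefunction, `√2 a_i† ψ = ((1 - iZ) q)_i ψ`. -/
theorem create_numberAmplitudes_gaussianWave {Z : Matrix (Fin 2) (Fin 2) ℂ}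
    (hZ : IsGaussianGraph Z) (n : Fin 2 → ℕ) (i : Fin 2) :
    Real.sqrt 2 * create i (numberAmplitudes (gaussianWave Z)) n =
      ∑ j, ((1 : Matrix (Fin 2) (Fin 2) ℂ) - Complex.I • Z) i j *
        ∫ q : Fin 2 → ℝ, (q j : ℂ) * (numberWave₂ n q * gaussianWave Z q) := by
  have h1 := annih_add_create_numberAmplitudes (memLp_gaussianWave hZ) n i
  have h2 := annih_numberAmplitudes_gaussianWave hZ n i
  -- Multiplying `h1` by `√2` gives `2 q_i`, and `2 - (1 + iZ) = 1 - iZ`.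
  have h3 : (Real.sqrt 2 : ℂ) * Real.sqrt 2 = 2 := by
    norm_cast; exact Real.mul_self_sqrt (by norm_num)
  rw [Fin.sum_univ_two] at h2 ⊢
  simp only [Matrix.add_apply, Matrix.sub_apply] at h2 ⊢
  fin_cases i <;> simp [Matrix.one_apply] at h1 h2 ⊢
  · linear_combination (Real.sqrt 2 : ℂ) * h1 - h2 +
      (∫ q : Fin 2 → ℝ, (q 0 : ℂ) * (numberWave₂ n q * gaussianWave Z q)) * h3
  · linear_combination (Real.sqrt 2 : ℂ) * h1 - h2 +
      (∫ q : Fin 2 → ℝ, (q 1 : ℂ) * (numberWave₂ n q * gaussianWave Z q)) * h3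

/-! ### Fixed vectors of the exponential of a self-adjoint operator -/

theorem exp_apply_of_apply_eq_smul {E : Type*} [NormedAddCommGroup E] [InnerProductSpace ℂ E]
    [CompleteSpace E] {A : E →L[ℂ] E} {a : ℂ} {w : E} (h : A w = a • w) :
    NormedSpace.exp A w = Complex.exp a • w := by
  have hp (k : ℕ) : (A ^ k) w = a ^ k • w := by
    induction k with
    | zero => simp
    | succ k ih =>
      rw [pow_succ']
      change A ((A ^ k) w) = _
      rw [ih, map_smul, h, smul_smul, pow_succ]
  have h1 := (NormedSpace.exp_series_hasSum_exp' (𝕂 := ℂ) A).mapL (ContinuousLinearMap.apply ℂ E w)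
  have h2 := (NormedSpace.exp_series_hasSum_exp' (𝕂 := ℂ) a).smul_const w
  rw [← Complex.exp_eq_exp_ℂ] at h2
  refine h1.unique (h2.congr_fun fun k => ?_)
  simp [hp, smul_smul]

/-- Expand `v` in an orthonormal eigenbasis of `T`. A nonzero coefficient forces `e^{-il} = 1`,
hence `l ∈ 2πℤ`, and `hev` leaves only `l = 0`. -/
theorem apply_eq_zero_of_exp_apply_eq {E : Type*} [NormedAddCommGroup E] [InnerProductSpace ℂ E]
    [FiniteDimensional ℂ E] [CompleteSpace E] {T : E →L[ℂ] E} (hT : IsSelfAdjoint T)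
    (hev : ∀ (l : ℝ) (w : E), w ≠ 0 → T w = (l : ℂ) • w → ∀ k : ℤ, k ≠ 0 → l ≠ 2 * Real.pi * k)
    {v : E} (hv : NormedSpace.exp ((-Complex.I) • T) v = v) : T v = 0 := by
  have hs : (T : E →ₗ[ℂ] E).IsSymmetric := ContinuousLinearMap.isSelfAdjoint_iff_isSymmetric.1 hT
  let b := hs.eigenvectorBasis rfl
  let l := hs.eigenvalues rfl
  have hb (i) : T (b i) = (l i : ℂ) • b i := hs.apply_eigenvectorBasis rfl i
  have he (i) : NormedSpace.exp ((-Complex.I) • T) (b i) =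
      Complex.exp (-Complex.I * l i) • b i := by
    refine exp_apply_of_apply_eq_smul ?_
    rw [smul_apply, hb, smul_smul]
  have hvs := b.sum_repr v
  have h0 (i) : b.repr v i * (l i : ℂ) = 0 := by
    have h1 : ∑ i, (Complex.exp (-Complex.I * l i) * b.repr v i) • b i = v := by
      conv_rhs => rw [← hv, ← hvs]
      rw [map_sum]
      refine Finset.sum_congr rfl fun i _ => ?_
      rw [map_smul, he, smul_smul, mul_comm]
    have h2 : Complex.exp (-Complex.I * l i) * b.repr v i = b.repr v i := by
      have h3 := congrArg (fun u => inner ℂ (b i) u) h1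
      simpa only [b.orthonormal.inner_right_fintype, ← b.repr_apply_apply] using h3
    by_cases hr : b.repr v i = 0
    · rw [hr, zero_mul]
    have h4 : Complex.exp (-Complex.I * l i) = 1 := mul_right_cancel₀ hr (by rw [h2, one_mul])
    obtain ⟨k, hk⟩ := Complex.exp_eq_one_iff.1 h4
    -- The sign comes from `-i l = 2πik`.
    have hk' : (l i : ℂ) = ((2 * Real.pi * (-k : ℤ) : ℝ) : ℂ) := by
      push_cast
      have hI := Complex.I_mul_I
      linear_combination Complex.I * hk + ((l i : ℂ) + 2 * Real.pi * k) * hI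
    have hl : l i = 2 * Real.pi * (-k : ℤ) := by exact_mod_cast hk'
    by_cases hk0 : -k = 0
    · rw [hk', hk0]; simp
    · exact absurd hl (hev (l i) (b i) (b.orthonormal.ne_zero i) (hb i) (-k) hk0)
  rw [← hvs, map_sum]
  refine Finset.sum_eq_zero fun i _ => ?_
  rw [map_smul, hb, smul_smul, h0, zero_smul]

/-! ### Matrix elements of the generator -/

theorem create_comm (i j : Fin 2) : create i * create j = create j * create i := by
  refine LinearMap.ext fun c => funext fun n => ?_
  rcases eq_or_ne i j with rfl | h
  · rfl
  · simp only [Module.End.mul_apply, create, LinearMap.coe_mk, AddHom.coe_mk, Pi.sub_apply,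
      Pi.single_eq_of_ne h, Pi.single_eq_of_ne h.symm, Nat.sub_zero, tsub_right_comm]
    ring

theorem generator_apply (α β γ δ : ℝ) (c : Amplitudes) :
    generator α β γ δ c = (1 / 2 : ℂ) •
      (((α : ℂ) + δ) • create 0 (annih 0 c) + ((α : ℂ) - δ) • create 1 (annih 1 c) +
        ((β : ℂ) - Complex.I * γ) • create 0 (annih 1 c) +
        ((β : ℂ) + Complex.I * γ) • create 1 (annih 0 c)) := by
  have hI : (1 : ℂ) / (2 * Complex.I) = -Complex.I / 2 := by
    field_simp; simp
  simp only [generator, S0, Sx, Sy, Sz, hI, LinearMap.add_apply, LinearMap.smul_apply,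
    LinearMap.sub_apply, Module.End.mul_apply]
  module

/-- This and the next two lemmas are the rows of the 3×3 matrix of the generator on two photons,
scaled by `√2` to avoid denominators. It is `α` plus the spin-one representation of `(β, γ, δ)`. -/
theorem generator_apply_two_zero (α β γ δ : ℝ) (c : Amplitudes) :
    Real.sqrt 2 * generator α β γ δ c ![2, 0] =
      Real.sqrt 2 * ((α : ℂ) + δ) * c ![2, 0] + ((β : ℂ) - Complex.I * γ) * c ![1, 1] := by
  have h : (Real.sqrt 2 : ℂ) * Real.sqrt 2 = 2 := by
    norm_cast; exact Real.mul_self_sqrt (by norm_num)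
  have e1 : (![2, 0] : Fin 2 → ℕ) - Pi.single 0 1 = ![1, 0] := by decide
  have e2 : (![1, 0] : Fin 2 → ℕ) + Pi.single 0 1 = ![2, 0] := by decide
  have e3 : (![1, 0] : Fin 2 → ℕ) + Pi.single 1 1 = ![1, 1] := by decide
  rw [generator_apply]
  simp [create, annih, e1, e2, e3, one_add_one_eq_two]
  linear_combination ((((α : ℂ) + δ) * Real.sqrt 2 * c ![2, 0]  +
    ((β : ℂ) - Complex.I * γ) * c ![1, 1]) / 2) * h

theorem generator_apply_zero_two (α β γ δ : ℝ) (c : Amplitudes) :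
    Real.sqrt 2 * generator α β γ δ c ![0, 2] =
      Real.sqrt 2 * ((α : ℂ) - δ) * c ![0, 2] + ((β : ℂ) + Complex.I * γ) * c ![1, 1] := by
  have h : (Real.sqrt 2 : ℂ) * Real.sqrt 2 = 2 := by
    norm_cast; exact Real.mul_self_sqrt (by norm_num)
  have e1 : (![0, 2] : Fin 2 → ℕ) - Pi.single 1 1 = ![0, 1] := by decide
  have e2 : (![0, 1] : Fin 2 → ℕ) + Pi.single 1 1 = ![0, 2] := by decide
  have e3 : (![0, 1] : Fin 2 → ℕ) + Pi.single 0 1 = ![1, 1] := by decide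
  rw [generator_apply]
  simp [create, annih, e1, e2, e3, one_add_one_eq_two]
  linear_combination ((((α : ℂ) - δ) * Real.sqrt 2 * c ![0, 2]  +
    ((β : ℂ) + Complex.I * γ) * c ![1, 1]) / 2) * h

theorem generator_apply_one_one (α β γ δ : ℝ) (c : Amplitudes) :
    Real.sqrt 2 * generator α β γ δ c ![1, 1] =
      Real.sqrt 2 * α * c ![1, 1] + ((β : ℂ) - Complex.I * γ) * c ![0, 2] +
        ((β : ℂ) + Complex.I * γ) * c ![2, 0] := by
  have h : (Real.sqrt 2 : ℂ) * Real.sqrt 2 = 2 := by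
    norm_cast; exact Real.mul_self_sqrt (by norm_num)
  have e1 : (![1, 1] : Fin 2 → ℕ) - Pi.single 0 1 = ![0, 1] := by decide
  have e2 : (![1, 1] : Fin 2 → ℕ) - Pi.single 1 1 = ![1, 0] := by decide
  have e3 : (![0, 1] : Fin 2 → ℕ) + Pi.single 0 1 = ![1, 1] := by decide
  have e4 : (![0, 1] : Fin 2 → ℕ) + Pi.single 1 1 = ![0, 2] := by decide
  have e5 : (![1, 0] : Fin 2 → ℕ) + Pi.single 0 1 = ![2, 0] := by decide
  have e6 : (![1, 0] : Fin 2 → ℕ) + Pi.single 1 1 = ![1, 1] := by decide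
  rw [generator_apply]
  simp [create, annih, e1, e2, e3, e4, e5, e6, one_add_one_eq_two]
  linear_combination ((((β : ℂ) - Complex.I * γ) * c ![0, 2] +
        ((β : ℂ) + Complex.I * γ) * c ![2, 0]) / 2) * h

/-- The generator has at most the eigenvalues `α`, `α ± r` on total photon number `2`. -/
theorem eigenvalue_secGen_two {α β γ δ l : ℝ}
    {w : EuclideanSpace ℂ (Finset.HasAntidiagonal.antidiagonal 2)} (hw : w ≠ 0)
    (h : secGen 2 α β γ δ w = (l : ℂ) • w) :
    l = α ∨ l = α + Real.sqrt (β ^ 2 + γ ^ 2 + δ ^ 2) ∨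
      l = α - Real.sqrt (β ^ 2 + γ ^ 2 + δ ^ 2) := by
  set c := ext 2 w with hc
  have hw' : res 2 c = w := res_ext 2 w
  have hG : res 2 (generator α β γ δ c) = (l : ℂ) • res 2 c := by rw [res_generator, hw', h]
  have hp (p : ℕ × ℕ) (hp : p ∈ Finset.HasAntidiagonal.antidiagonal 2) :
      generator α β γ δ c (lab p) = l * c (lab p) := by
    have := congrArg (fun u => u ⟨p, hp⟩) hG
    simpa using this
  have h20 : generator α β γ δ c ![2, 0] = l * c ![2, 0] := hp (2, 0) (by simp)
  have h11 : generator α β γ δ c ![1, 1] = l * c ![1, 1] := hp (1, 1) (by simp)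
  have h02 : generator α β γ δ c ![0, 2] = l * c ![0, 2] := hp (0, 2) (by simp)
  have g20 := generator_apply_two_zero α β γ δ c
  have g11 := generator_apply_one_one α β γ δ c
  have g02 := generator_apply_zero_two α β γ δ c
  rw [h20] at g20
  rw [h11] at g11
  rw [h02] at g02
  set x := c ![2, 0]
  set y := c ![1, 1]
  set z := c ![0, 2]
  have hs : (Real.sqrt 2 : ℂ) * Real.sqrt 2 = 2 := by
    norm_cast; exact Real.mul_self_sqrt (by norm_num)
  set s : ℂ := (Real.sqrt 2 : ℂ)
  have hs0 : s ≠ 0 := by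
    intro h0; rw [h0] at hs; norm_num at hs
  have hxyz : ¬ (x = 0 ∧ y = 0 ∧ z = 0) := by
    rintro ⟨hx, hy, hz⟩
    refine hw ?_
    rw [← hw']
    refine PiLp.ext fun p => ?_
    obtain ⟨⟨a, b⟩, hab⟩ := p
    have hab' := Finset.HasAntidiagonal.mem_antidiagonal.1 hab
    simp only at hab'
    obtain ⟨rfl, rfl⟩ | ⟨rfl, rfl⟩ | ⟨rfl, rfl⟩ :
      (a = 2 ∧ b = 0) ∨ (a = 1 ∧ b = 1) ∨ (a = 0 ∧ b = 2) := by omega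
    · exact hx
    · exact hy
    · exact hz
  -- The left side is the characteristic polynomial of the two-photon matrix at `l`.
  have hD : ((l - α : ℝ) : ℂ) *
      (((l - α) ^ 2 - (β ^ 2 + γ ^ 2 + δ ^ 2) : ℝ) : ℂ) = 0 := by
    have hI : Complex.I * Complex.I = -1 := Complex.I_mul_I
    push_cast
    have huv : ((β : ℂ) - Complex.I * γ) * ((β : ℂ) + Complex.I * γ) = β ^ 2 + γ ^ 2 := by
      linear_combination -(γ : ℂ) ^ 2 * hI
    set u : ℂ := (β : ℂ) - Complex.I * γ
    set v : ℂ := (β : ℂ) + Complex.I * γ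
    set m : ℂ := (l : ℂ) - α with hm
    by_contra hD
    -- Cramer's rule: here and in `hz`, `hy` the multipliers of the three equations form, up to
    -- scale, a row of the adjugate of `l - G`.
    have hx : (m * (m ^ 2 - ((β : ℂ) ^ 2 + (γ : ℂ) ^ 2 + (δ : ℂ) ^ 2))) * (2 * s * x) = 0 := by
      rw [hm]
      linear_combination (2 * ((l : ℂ) - α) * ((l : ℂ) - α + δ) - u * v) * g20 +
        s * u * ((l : ℂ) - α + δ) * g11 + u ^ 2 * g02 -
        u * ((l : ℂ) - α + δ) * ((l : ℂ) - α) * y * hs + 2 * s * ((l : ℂ) - α) * x * huv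
    have hz : (m * (m ^ 2 - ((β : ℂ) ^ 2 + (γ : ℂ) ^ 2 + (δ : ℂ) ^ 2))) * (2 * s * z) = 0 := by
      rw [hm]
      linear_combination (2 * ((l : ℂ) - α) * ((l : ℂ) - α - δ) - u * v) * g02 +
        s * v * ((l : ℂ) - α - δ) * g11 + v ^ 2 * g20 -
        v * ((l : ℂ) - α - δ) * ((l : ℂ) - α) * y * hs + 2 * s * ((l : ℂ) - α) * z * huv
    have hy : (m * (m ^ 2 - ((β : ℂ) ^ 2 + (γ : ℂ) ^ 2 + (δ : ℂ) ^ 2))) * (2 * y) = 0 := by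
      rw [hm]
      linear_combination s * (((l : ℂ) - α) ^ 2 - δ ^ 2) * g11 + u * ((l : ℂ) - α - δ) * g02 +
        v * ((l : ℂ) - α + δ) * g20 -
        ((l : ℂ) - α) * (((l : ℂ) - α) ^ 2 - δ ^ 2) * y * hs + 2 * ((l : ℂ) - α) * y * huv
    refine hxyz ⟨?_, ?_, ?_⟩
    · simpa [hD, hs0] using hx
    · simpa [hD] using hy
    · simpa [hD, hs0] using hz
  rcases mul_eq_zero.1 hD with h1 | h1
  · left
    have := Complex.ofReal_eq_zero.1 h1
    linarith
  · right
    have h2 := Complex.ofReal_eq_zero.1 h1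
    have h3 := Real.sq_sqrt (show 0 ≤ β ^ 2 + γ ^ 2 + δ ^ 2 by positivity)
    have h4 : (l - α - Real.sqrt (β ^ 2 + γ ^ 2 + δ ^ 2)) *
        (l - α + Real.sqrt (β ^ 2 + γ ^ 2 + δ ^ 2)) = 0 := by linear_combination h2 - h3
    rcases mul_eq_zero.1 h4 with h5 | h5
    · left; linarith
    · right; linarith

/-- Evolution acts on each photon-number sector separately, so the two-photon part of `c` is itself
a fixed vector, and `hr` rules out resonant eigenvalues there. -/
theorem res_two_generator_eq_zero_of_evolve_eq {α β γ δ : ℝ}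
    (hr : ∀ k : ℤ, k ≠ 0 → α ≠ 2 * Real.pi * k ∧
        α + Real.sqrt (β ^ 2 + γ ^ 2 + δ ^ 2) ≠ 2 * Real.pi * k ∧
        α - Real.sqrt (β ^ 2 + γ ^ 2 + δ ^ 2) ≠ 2 * Real.pi * k)
    {c : Amplitudes} (hc : evolve α β γ δ c = c) : res 2 (generator α β γ δ c) = 0 := by
  rw [res_generator]
  refine apply_eq_zero_of_exp_apply_eq (secGen_isSelfAdjoint 2 α β γ δ)
    (fun l w hw h k hk => ?_) (by rw [← res_evolve, hc])
  rcases eigenvalue_secGen_two hw h with rfl | rfl | rfl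
  exacts [(hr k hk).1, (hr k hk).2.1, (hr k hk).2.2]

/-! ### The vacuum amplitude of a Gaussian state -/

/-- After scaling by `Re a · |a|²`, the real part of the Schur complement is the real determinant
times `|a|²` plus a square. -/
theorem re_schur_complement_pos {a b c : ℂ} (ha : 0 < a.re) (h : 0 < a.re * c.re - b.re ^ 2) :
    0 < (c - b ^ 2 / a).re := by
  have hN : 0 < Complex.normSq a := Complex.normSq_pos.2 fun h0 => by simp [h0] at ha
  have e : (c - b ^ 2 / a).re * (a.re * Complex.normSq a) =
      (a.re * c.re - b.re ^ 2) * Complex.normSq a + (b.re * a.im - b.im * a.re) ^ 2 := by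
    simp only [Complex.sub_re, Complex.div_re, pow_two, Complex.mul_re, Complex.mul_im]
    field_simp
    rw [Complex.normSq_apply]
    ring
  refine pos_of_mul_pos_left (b := a.re * Complex.normSq a) ?_ (by positivity)
  rw [e]
  positivity

/-- Fubini and completing the square in the first variable leave a Gaussian in the second with the
Schur complement as coefficient. The value is a product of two square roots of nonzero numbers. -/
theorem integral_cexp_neg_quadratic_ne_zero {a b c : ℂ} (ha : 0 < a.re)
    (h : 0 < (c - b ^ 2 / a).re)
    (hi : MeasureTheory.Integrable fun q : Fin 2 → ℝ =>
      Complex.exp (-(a * (q 0 : ℂ) ^ 2 + 2 * b * q 0 * q 1 + c * (q 1 : ℂ) ^ 2) / 2)) :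
    ∫ q : Fin 2 → ℝ,
      Complex.exp (-(a * (q 0 : ℂ) ^ 2 + 2 * b * q 0 * q 1 + c * (q 1 : ℂ) ^ 2) / 2) ≠ 0 := by
  have ha0 : a ≠ 0 := fun h0 => by simp [h0] at ha
  set f : ℝ × ℝ → ℂ := fun p =>
    Complex.exp (-(a * (p.1 : ℂ) ^ 2 + 2 * b * p.1 * p.2 + c * (p.2 : ℂ) ^ 2) / 2) with hf
  have hmp := MeasureTheory.volume_preserving_finTwoArrow ℝ
  have hfi : MeasureTheory.Integrable f (MeasureTheory.volume.prod MeasureTheory.volume) :=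
    (hmp.integrable_comp_emb (MeasurableEquiv.measurableEmbedding _)).1 hi
  have e1 : ∫ q : Fin 2 → ℝ,
      Complex.exp (-(a * (q 0 : ℂ) ^ 2 + 2 * b * q 0 * q 1 + c * (q 1 : ℂ) ^ 2) / 2) =
      ∫ p, f p ∂(MeasureTheory.volume.prod MeasureTheory.volume) :=
    hmp.integral_comp (MeasurableEquiv.measurableEmbedding _) f
  have e2 (y : ℝ) : ∫ x : ℝ, f (x, y) = (Real.pi / (a / 2)) ^ (1 / 2 : ℂ) *
      Complex.exp (-((c - b ^ 2 / a) / 2) * (y : ℂ) ^ 2) := by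
    have h1 := integral_cexp_quadratic (b := -(a / 2))
      (by simpa using ha) (-(b * y)) (-(c * (y : ℂ) ^ 2 / 2))
    rw [neg_neg] at h1
    convert h1 using 2
    · simp only [hf]
      funext x
      congr 1
      ring
    · congr 1
      field_simp
      ring
  have hre : 0 < ((c - b ^ 2 / a) / 2).re := by simpa using h
  have hre0 : (c - b ^ 2 / a) / 2 ≠ 0 := fun h0 => by simp [h0] at hre
  have hpi : (Real.pi : ℂ) ≠ 0 := by exact_mod_cast Real.pi_ne_zero
  rw [e1, MeasureTheory.integral_prod_symm f hfi]
  simp only [e2]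
  rw [MeasureTheory.integral_const_mul, integral_gaussian_complex hre]
  refine mul_ne_zero ?_ ?_ <;>
    refine (Complex.cpow_ne_zero_iff_of_exponent_ne_zero (by norm_num)).2 (div_ne_zero hpi ?_)
  · simpa using ha0
  · exact hre0

/-- The real part of `1 - iZ` is `1 + Im Z`, which is positive definite. These two pivots give both
the invertibility of `1 - iZ` and the nonzero vacuum integral. -/
theorem IsGaussianGraph.re_pos {Z : Matrix (Fin 2) (Fin 2) ℂ} (hZ : IsGaussianGraph Z) :
    0 < (1 - Complex.I * Z 0 0).re ∧
      0 < ((1 - Complex.I * Z 1 1) - (-(Complex.I * Z 0 1)) ^ 2 / (1 - Complex.I * Z 0 0)).re := by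
  have hdet := hZ.posDef.det_pos
  rw [Matrix.det_fin_two] at hdet
  have h0 : 0 < (Z 0 0).im := hZ.posDef.diag_pos (i := 0)
  have h1 : 0 < (Z 1 1).im := hZ.posDef.diag_pos (i := 1)
  have hs : Z 1 0 = Z 0 1 := hZ.symm.apply 0 1
  simp only [Matrix.map_apply, hs] at hdet
  have ha : 0 < (1 - Complex.I * Z 0 0).re := by simp; positivity
  refine ⟨ha, re_schur_complement_pos ha ?_⟩
  simp
  -- With `u, v, w` the entries of `Im Z`: `(1 + u)(1 + w) - v² = 1 + u + w + (uw - v²)`.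
  nlinarith

theorem IsGaussianGraph.isUnit_det {Z : Matrix (Fin 2) (Fin 2) ℂ} (hZ : IsGaussianGraph Z) :
    IsUnit (1 - Complex.I • Z).det := by
  obtain ⟨h0, h1⟩ := hZ.re_pos
  have hs : Z 1 0 = Z 0 1 := hZ.symm.apply 0 1
  have ha : 1 - Complex.I * Z 0 0 ≠ 0 := fun h => by simp [h] at h0
  have e : (1 - Complex.I • Z).det = (1 - Complex.I * Z 0 0) *
      ((1 - Complex.I * Z 1 1) - (-(Complex.I * Z 0 1)) ^ 2 / (1 - Complex.I * Z 0 0)) := by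
    rw [Matrix.det_fin_two]
    simp [hs]
    field_simp
  rw [e, isUnit_iff_ne_zero]
  exact mul_ne_zero ha fun h => by rw [h] at h1; simp at h1

/-- The vacuum wave is itself Gaussian, so the amplitude is a Gaussian integral with matrix `1 -
iZ`. -/
theorem numberAmplitudes_gaussianWave_zero_ne_zero {Z : Matrix (Fin 2) (Fin 2) ℂ}
    (hZ : IsGaussianGraph Z) : numberAmplitudes (gaussianWave Z) 0 ≠ 0 := by
  obtain ⟨h0, h1⟩ := hZ.re_pos
  have hs : Z 1 0 = Z 0 1 := hZ.symm.apply 0 1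
  have hdet : 0 < (Z.map Complex.im).det := hZ.posDef.det_pos
  obtain ⟨N, hN⟩ : ∃ N : ℝ, N = ((Real.pi ^ (1 / 4 : ℝ))⁻¹ * (Real.pi ^ (1 / 4 : ℝ))⁻¹) *
    ((Z.map Complex.im).det ^ (1 / 4 : ℝ) / Real.pi ^ (2 / 4 : ℝ)) := ⟨_, rfl⟩
  have hN0 : (N : ℂ) ≠ 0 := by
    have : 0 < N := by rw [hN]; positivity
    exact_mod_cast this.ne'
  have e (q : Fin 2 → ℝ) : numberWave₂ 0 q * gaussianWave Z q = N *
      Complex.exp (-((1 - Complex.I * Z 0 0) * (q 0 : ℂ) ^ 2 +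
        2 * (-(Complex.I * Z 0 1)) * q 0 * q 1 + (1 - Complex.I * Z 1 1) * (q 1 : ℂ) ^ 2) / 2) := by
    have h2 : numberWave₂ 0 q = (((Real.pi ^ (1 / 4 : ℝ))⁻¹ * (Real.pi ^ (1 / 4 : ℝ))⁻¹ : ℝ) : ℂ) *
        (Complex.exp (-((q 0 : ℂ) ^ 2) / 2) * Complex.exp (-((q 1 : ℂ) ^ 2) / 2)) := by
      simp only [numberWave₂, numberWave, Fin.prod_univ_two, Pi.zero_apply, Polynomial.hermite_zero,
        map_one, Nat.factorial_zero, Nat.cast_one, Real.sqrt_one, mul_one, one_mul]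
      push_cast
      ring
    rw [h2, gaussianWave, hN, mul_mul_mul_comm]
    congr 1
    · push_cast; ring
    rw [← Complex.exp_add, ← Complex.exp_add]
    congr 1
    simp only [Fin.sum_univ_two, hs]
    ring
  have hi := integrable_numberWave₂_mul (memLp_gaussianWave hZ) 0
  have ha : numberAmplitudes (gaussianWave Z) 0 =
      ∫ q, numberWave₂ 0 q * gaussianWave Z q := rfl
  rw [ha]
  simp only [e] at hi ⊢
  rw [MeasureTheory.integral_const_mul]
  refine mul_ne_zero hN0 (integral_cexp_neg_quadratic_ne_zero h0 h1 ?_)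
  refine (hi.const_mul (N : ℂ)⁻¹).congr (Filter.Eventually.of_forall fun q => ?_)
  simp only
  rw [inv_mul_cancel_left₀ hN0]

/-! ### The adjacency matrix and the annihilation relations -/

/-- Transposition reverses the two symmetric factors, and `1 + iZ` commutes with `(1 - iZ)⁻¹`. -/
theorem adjacency_isSymm {Z : Matrix (Fin 2) (Fin 2) ℂ} (hZ : IsGaussianGraph Z) :
    (adjacency Z).IsSymm := by
  have hA := hZ.isUnit_det
  have hc : (1 - Complex.I • Z) * (1 + Complex.I • Z) =
      (1 + Complex.I • Z) * (1 - Complex.I • Z) := by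
    generalize Complex.I • Z = X
    noncomm_ring
  rw [Matrix.IsSymm, adjacency, Matrix.transpose_mul, Matrix.transpose_nonsing_inv,
    Matrix.transpose_sub, Matrix.transpose_add, Matrix.transpose_smul, Matrix.transpose_one,
    hZ.symm.eq]
  calc (1 - Complex.I • Z)⁻¹ * (1 + Complex.I • Z)
      = (1 - Complex.I • Z)⁻¹ * ((1 + Complex.I • Z) * (1 - Complex.I • Z)) *
          (1 - Complex.I • Z)⁻¹ := by
        rw [Matrix.mul_assoc, Matrix.mul_nonsing_inv_cancel_right _ _ hA]
    _ = (1 + Complex.I • Z) * (1 - Complex.I • Z)⁻¹ := by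
        rw [← hc, Matrix.nonsing_inv_mul_cancel_left _ _ hA]

/-- The nullifier relations `a_i ψ_Z = ∑ j, K_{ij} a_j† ψ_Z`. -/
theorem annih_eq_adjacency_create {Z : Matrix (Fin 2) (Fin 2) ℂ} (hZ : IsGaussianGraph Z)
    (i : Fin 2) :
    annih i (numberAmplitudes (gaussianWave Z)) =
      adjacency Z i 0 • create 0 (numberAmplitudes (gaussianWave Z)) +
        adjacency Z i 1 • create 1 (numberAmplitudes (gaussianWave Z)) := by
  funext n
  have h2 : (Real.sqrt 2 : ℂ) ≠ 0 := by
    exact_mod_cast (Real.sqrt_pos.2 (by norm_num : (0 : ℝ) < 2)).ne'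
  have hK : adjacency Z * (1 - Complex.I • Z) = 1 + Complex.I • Z := by
    rw [adjacency, Matrix.nonsing_inv_mul_cancel_right _ _ hZ.isUnit_det]
  have hK0 := congrFun (congrFun hK i) 0
  have hK1 := congrFun (congrFun hK i) 1
  rw [Matrix.mul_apply, Fin.sum_univ_two] at hK0 hK1
  have ha := annih_numberAmplitudes_gaussianWave hZ n i
  have hc0 := create_numberAmplitudes_gaussianWave hZ n 0
  have hc1 := create_numberAmplitudes_gaussianWave hZ n 1
  rw [Fin.sum_univ_two] at ha hc0 hc1
  refine mul_left_cancel₀ h2 ?_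
  simp only [Pi.add_apply, Pi.smul_apply, smul_eq_mul]
  rw [ha, ← hK0, ← hK1]
  linear_combination -adjacency Z i 0 * hc0 - adjacency Z i 1 * hc1

/-- On a Gaussian state the generator acts as a quadratic form in the creation operators, whose
coefficients are the left-hand sides of the constraints. -/
theorem generator_numberAmplitudes_gaussianWave {Z : Matrix (Fin 2) (Fin 2) ℂ}
    (hZ : IsGaussianGraph Z) (α β γ δ : ℝ) :
    generator α β γ δ (numberAmplitudes (gaussianWave Z)) = (1 / 2 : ℂ) •
      ((((α : ℂ) + δ) * adjacency Z 0 0 + (β - Complex.I * γ) * adjacency Z 0 1) •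
          create 0 (create 0 (numberAmplitudes (gaussianWave Z))) +
        ((β + Complex.I * γ) * adjacency Z 0 1 + ((α : ℂ) - δ) * adjacency Z 1 1) •
          create 1 (create 1 (numberAmplitudes (gaussianWave Z))) +
        (2 * (α : ℂ) * adjacency Z 0 1 + (β - Complex.I * γ) * adjacency Z 1 1 +
          (β + Complex.I * γ) * adjacency Z 0 0) •
          create 0 (create 1 (numberAmplitudes (gaussianWave Z)))) := by
  have hs : adjacency Z 1 0 = adjacency Z 0 1 := (adjacency_isSymm hZ).apply 0 1
  have hc : create 1 (create 0 (numberAmplitudes (gaussianWave Z))) =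
      create 0 (create 1 (numberAmplitudes (gaussianWave Z))) :=
    congrArg (fun T : Module.End ℂ Amplitudes => T (numberAmplitudes (gaussianWave Z)))
      (create_comm 1 0)
  rw [generator_apply, annih_eq_adjacency_create hZ 0, annih_eq_adjacency_create hZ 1]
  simp only [map_add, map_smul, hs, hc]
  module

/-! ### Invariance of the Gaussian state versus the constraints -/

theorem evolve_eq_self_of_generator_eq_zero {α β γ δ : ℝ} {c : Amplitudes}
    (h : generator α β γ δ c = 0) : evolve α β γ δ c = c := by
  funext n
  rw [evolve, tsum_eq_single 0]
  · simp
  · intro k hk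
    obtain ⟨k, rfl⟩ := Nat.exists_eq_succ_of_ne_zero hk
    rw [pow_succ (generator α β γ δ), Module.End.mul_apply, h]
    simp

theorem passiveUnitary_gaussianState_eq_iff {α β γ δ : ℝ} {Z : Matrix (Fin 2) (Fin 2) ℂ}
    (hZ : IsGaussianGraph Z) :
    passiveUnitary α β γ δ (gaussianState Z hZ) = gaussianState Z hZ ↔
      evolve α β γ δ (numberAmplitudes (gaussianWave Z)) = numberAmplitudes (gaussianWave Z) :=
  Subtype.ext_iff

theorem passiveUnitary_gaussianState_of_constraints {α β γ δ : ℝ}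
    {Z : Matrix (Fin 2) (Fin 2) ℂ} (hZ : IsGaussianGraph Z)
    (h : Constraints α β γ δ (adjacency Z)) :
    passiveUnitary α β γ δ (gaussianState Z hZ) = gaussianState Z hZ := by
  rw [passiveUnitary_gaussianState_eq_iff]
  refine evolve_eq_self_of_generator_eq_zero ?_
  rw [generator_numberAmplitudes_gaussianWave hZ, h.1, h.2.1, h.2.2]
  simp

theorem constraints_of_passiveUnitary_gaussianState {α β γ δ : ℝ}
    {Z : Matrix (Fin 2) (Fin 2) ℂ} (hZ : IsGaussianGraph Z)
    (hr : ∀ k : ℤ, k ≠ 0 → α ≠ 2 * Real.pi * k ∧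
        α + Real.sqrt (β ^ 2 + γ ^ 2 + δ ^ 2) ≠ 2 * Real.pi * k ∧
        α - Real.sqrt (β ^ 2 + γ ^ 2 + δ ^ 2) ≠ 2 * Real.pi * k)
    (h : passiveUnitary α β γ δ (gaussianState Z hZ) = gaussianState Z hZ) :
    Constraints α β γ δ (adjacency Z) := by
  have hG := res_two_generator_eq_zero_of_evolve_eq hr ((passiveUnitary_gaussianState_eq_iff hZ).1 h)
  have hp (p : ℕ × ℕ) (hp : p ∈ Finset.HasAntidiagonal.antidiagonal 2) :
      generator α β γ δ (numberAmplitudes (gaussianWave Z)) (lab p) = 0 :=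
    congrArg (fun u => u ⟨p, hp⟩) hG
  have h20 : generator α β γ δ (numberAmplitudes (gaussianWave Z)) ![2, 0] = 0 :=
    hp (2, 0) (by simp)
  have h11 : generator α β γ δ (numberAmplitudes (gaussianWave Z)) ![1, 1] = 0 :=
    hp (1, 1) (by simp)
  have h02 : generator α β γ δ (numberAmplitudes (gaussianWave Z)) ![0, 2] = 0 :=
    hp (0, 2) (by simp)
  have h0 := numberAmplitudes_gaussianWave_zero_ne_zero hZ
  have e1 : (![2, 0] : Fin 2 → ℕ) - Pi.single 0 1 = ![1, 0] := by decide
  have e2 : (![1, 0] : Fin 2 → ℕ) - Pi.single 0 1 = 0 := by decide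
  have e3 : (![0, 2] : Fin 2 → ℕ) - Pi.single 1 1 = ![0, 1] := by decide
  have e4 : (![0, 1] : Fin 2 → ℕ) - Pi.single 1 1 = 0 := by decide
  have e5 : (![1, 1] : Fin 2 → ℕ) - Pi.single 0 1 = ![0, 1] := by decide
  rw [generator_numberAmplitudes_gaussianWave hZ] at h20 h11 h02
  -- At each label exactly one quadratic monomial reaches the vacuum amplitude; the other two die on
  -- a factor `√0`.
  simp [create, e1, e2, e3, e4, e5, h0] at h20 h11 h02
  exact ⟨h20, h02, h11⟩

/-! ### Rescaling the angle -/

theorem constraints_smul_iff {α β γ δ t : ℝ} (ht : t ≠ 0) {K : Matrix (Fin 2) (Fin 2) ℂ} :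
    Constraints (t * α) (t * β) (t * γ) (t * δ) K ↔ Constraints α β γ δ K := by
  have ht' : (t : ℂ) ≠ 0 := by exact_mod_cast ht
  have h (x y : ℂ) (hxy : x = t * y) : x = 0 ↔ y = 0 := by simp [hxy, ht']
  refine and_congr (h _ _ ?_) (and_congr (h _ _ ?_) (h _ _ ?_)) <;> push_cast <;> ring

theorem ne_two_pi_mul_of_abs_lt {x : ℝ} (hx : |x| < 2 * Real.pi) {k : ℤ} (hk : k ≠ 0) :
    x ≠ 2 * Real.pi * k := by
  rintro rfl
  have h1 : (1 : ℝ) ≤ |(k : ℝ)| := by exact_mod_cast Int.one_le_abs hk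
  rw [abs_mul, abs_of_pos Real.two_pi_pos] at hx
  nlinarith [Real.two_pi_pos]

theorem exists_pos_no_phase_return (α β γ δ : ℝ) : ∃ t : ℝ, 0 < t ∧ ∀ k : ℤ, k ≠ 0 →
    t * α ≠ 2 * Real.pi * k ∧
    t * α + Real.sqrt ((t * β) ^ 2 + (t * γ) ^ 2 + (t * δ) ^ 2) ≠ 2 * Real.pi * k ∧
    t * α - Real.sqrt ((t * β) ^ 2 + (t * γ) ^ 2 + (t * δ) ^ 2) ≠ 2 * Real.pi * k := by
  set r := Real.sqrt (β ^ 2 + γ ^ 2 + δ ^ 2) with hr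
  have hr0 : 0 ≤ r := Real.sqrt_nonneg _
  have hD : 0 < 1 + |α| + r := by positivity
  have ht : 0 < (1 + |α| + r)⁻¹ := inv_pos.2 hD
  have hpi := Real.pi_gt_three
  -- With this `t`, `|tα| + tr = 1 - t < 2π`, so all three phases lie strictly between `-2π` and
  -- `2π`.
  refine ⟨(1 + |α| + r)⁻¹, ht, fun k hk => ?_⟩
  set t := (1 + |α| + r)⁻¹ with htdef
  have htD : t * (1 + |α| + r) = 1 := inv_mul_cancel₀ hD.ne'
  have hs : Real.sqrt ((t * β) ^ 2 + (t * γ) ^ 2 + (t * δ) ^ 2) = t * r := by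
    rw [hr, show (t * β) ^ 2 + (t * γ) ^ 2 + (t * δ) ^ 2 = t ^ 2 * (β ^ 2 + γ ^ 2 + δ ^ 2) by ring,
      Real.sqrt_mul (by positivity), Real.sqrt_sq ht.le]
  have h1 : |t * α| + t * r < 2 * Real.pi := by
    rw [abs_mul, abs_of_pos ht]
    nlinarith
  have h2 : |t * r| = t * r := abs_of_nonneg (by positivity)
  rw [hs]
  refine ⟨ne_two_pi_mul_of_abs_lt ?_ hk, ne_two_pi_mul_of_abs_lt ?_ hk,
    ne_two_pi_mul_of_abs_lt ?_ hk⟩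
  · linarith [h2 ▸ abs_nonneg (t * r)]
  · linarith [abs_add_le (t * α) (t * r)]
  · linarith [abs_sub (t * α) (t * r)]

end Qumodes

end

theorem theorem4 (α β γ δ : ℝ) (Z : Matrix (Fin 2) (Fin 2) ℂ) (hZ : Qumodes.IsGaussianGraph Z) :
    -- the constraints always imply invariance under `U`
    (Qumodes.Constraints α β γ δ (Qumodes.adjacency Z) →
      Qumodes.passiveUnitary α β γ δ (Qumodes.gaussianState Z hZ) = Qumodes.gaussianState Z hZ) ∧
    -- they characterize invariance under `U`, unless one of the three phases `e^{-iα}`,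
    -- `e^{-i(α ± r)}`, `r = √(β² + γ² + δ²)`, is a nontrivial return to 1
    ((∀ k : ℤ, k ≠ 0 → α ≠ 2 * Real.pi * k ∧
        α + Real.sqrt (β ^ 2 + γ ^ 2 + δ ^ 2) ≠ 2 * Real.pi * k ∧
        α - Real.sqrt (β ^ 2 + γ ^ 2 + δ ^ 2) ≠ 2 * Real.pi * k) →
      (Qumodes.passiveUnitary α β γ δ (Qumodes.gaussianState Z hZ) = Qumodes.gaussianState Z hZ ↔
        Qumodes.Constraints α β γ δ (Qumodes.adjacency Z))) ∧
    -- they always characterize invariance under `U(θ)` for all `θ`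
    ((∀ θ : ℝ, Qumodes.passiveUnitary (θ * α) (θ * β) (θ * γ) (θ * δ) (Qumodes.gaussianState Z hZ) =
        Qumodes.gaussianState Z hZ) ↔
      Qumodes.Constraints α β γ δ (Qumodes.adjacency Z)) := by
  refine ⟨Qumodes.passiveUnitary_gaussianState_of_constraints hZ,
    fun hr => ⟨Qumodes.constraints_of_passiveUnitary_gaussianState hZ hr,
      Qumodes.passiveUnitary_gaussianState_of_constraints hZ⟩, fun h => ?_, fun h θ => ?_⟩
  · obtain ⟨t, ht, hr⟩ := Qumodes.exists_pos_no_phase_return α β γ δ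
    exact (Qumodes.constraints_smul_iff ht.ne').1
      (Qumodes.constraints_of_passiveUnitary_gaussianState hZ hr (h t))
  -- Rescaling needs `θ ≠ 0`; at `θ = 0` the constraints are trivial.
  · rcases eq_or_ne θ 0 with rfl | hθ
    · refine Qumodes.passiveUnitary_gaussianState_of_constraints hZ ?_
      simp [Qumodes.Constraints]
    · exact Qumodes.passiveUnitary_gaussianState_of_constraints hZ
        ((Qumodes.constraints_smul_iff hθ).2 h)
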